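/- For a continuous function $f\colon\mathbb{R}\to\mathbb{R}$, $x\in\mathbb{R}$ and $h>0$ let $$\Delta_2 f(x,h)=\frac{f(x+h)-2f(x)+f(x-h)}{h},\qquad \|f\|_*=\sup_{x\in\mathbb{R},\,h>0}|\Delta_2 f(x,h)|,$$ and let the Zygmund class $\Lambda_*$ be the set of continuous $f\colon\mathbb{R}\to\mathbb{R}$ with $\|f\|_*<\infty$. Let $\operatorname{BMO}$ be the set of locally integrable $\varphi\colon\mathbb{R}\to\mathbb{R}$ with $$\sup_I\left(\frac1{|I|}\int_I|\varphi(x)-\varphi_I|^2\,dx\right)^{1/2}<\infty,\qquad \varphi_I=\frac1{|I|}\int_I\varphi(x)\,dx,$$ where $I$ ranges over all finite (nondegenerate) intervals, and let $\operatorname{I}(\operatorname{BMO})$ be the set of continuous $g\colon\mathbb{R}\to\mathbb{R}$ whose derivative in the sense of distributions is a function in $\operatorname{BMO}$. For $f\in\Lambda_*$ put $$\operatorname{dist}(f,\operatorname{I}(\operatorname{BMO}))=\inf\{\|f-g\|_*\colon g\in\operatorname{I}(\operatorname{BMO})\},$$ and for $\varepsilon>0$ put $A(f,\varepsilon)=\{(x,h)\colon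 x\in\mathbb{R},\ h>0,\ |\Delta_2 f(x,h)|>\varepsilon\}$ and $$C(f,\varepsilon)=\sup_I\frac1{|I|}\int_I\int_0^{|I|}\chi_{A(f,\varepsilon)}(x,h)\,\frac{dh\,dx}{h}\in[0,\infty],$$ where $I$ ranges over all finite (nondegenerate) intervals and $\chi_A$ denotes the indicator function of $A$. Theorem. There is an absolute constant $K>0$ such that for every compactly supported $f\in\Lambda_*$, $$\operatorname{dist}(f,\operatorname{I}(\operatorname{BMO}))\le K\,\inf\{\varepsilon>0\colon C(f,\varepsilon)<\infty\}\quad\text{and}\quad \inf\{\varepsilon>0\colon C(f,\varepsilon)<\infty\}\le K\,\operatorname{dist}(f,\operatorname{I}(\operatorname{BMO})).$$ -/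

import Mathlib

open MeasureTheory Set
open scoped ENNReal NNReal

noncomputable section

/-- The second divided difference `Δ₂f(x,h)` of `f` centred at `x` with step `h`
(used only for `h > 0`). -/
def secondDividedDifference (f : ℝ → ℝ) (x h : ℝ) : ℝ :=
  (f (x + h) - 2 * f x + f (x - h)) / h

/-- The Zygmund seminorm `‖f‖_* = sup_{x ∈ ℝ, h > 0} |Δ₂f(x,h)|`, with values in `[0,∞]`. -/
def zygmundSeminorm (f : ℝ → ℝ) : ℝ≥0∞ :=
  ⨆ (x : ℝ) (h : ℝ) (_ : 0 < h), ENNReal.ofReal |secondDividedDifference f x h|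

/-- The Zygmund class `Λ_*`. -/
def ZygmundClass : Set (ℝ → ℝ) :=
  {f | Continuous f ∧ zygmundSeminorm f < ∞}

/-- The norm `‖φ‖_BMO = sup_I (|I|⁻¹ ∫_I |φ - φ_I|²)^{1/2}` in `[0,∞]`, where `I = [a,b]` ranges over
all nondegenerate finite intervals and `φ_I` is the average of `φ` on `I`. -/
def bmoNorm (φ : ℝ → ℝ) : ℝ≥0∞ :=
  ⨆ (a : ℝ) (b : ℝ) (_ : a < b),
    ((ENNReal.ofReal (b - a))⁻¹ *
      ∫⁻ x in Icc a b, ENNReal.ofReal (|φ x - ⨍ y in Icc a b, φ y| ^ 2)) ^ (1 / 2 : ℝ)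

/-- The space `BMO` of locally integrable functions of bounded mean oscillation. -/
def BMO : Set (ℝ → ℝ) :=
  {φ | LocallyIntegrable φ volume ∧ bmoNorm φ < ∞}

/-- `φ` is the derivative of `g` in the sense of distributions on `ℝ`
(used for `g` continuous and `φ` locally integrable). -/
def IsDistributionalDeriv (g φ : ℝ → ℝ) : Prop :=
  ∀ η : ℝ → ℝ, ContDiff ℝ (⊤ : ℕ∞) η → HasCompactSupport η →
    ∫ x, g x * deriv η x = -∫ x, φ x * η x

/-- The space `I(BMO)` of continuous functions whose distributional derivative is in `BMO`. -/
def IBMO : Set (ℝ → ℝ) :=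
  {g | Continuous g ∧ ∃ φ ∈ BMO, IsDistributionalDeriv g φ}

/-- `dist(f, I(BMO))` in the Zygmund seminorm. -/
def distIBMO (f : ℝ → ℝ) : ℝ≥0∞ :=
  ⨅ g ∈ IBMO, zygmundSeminorm (f - g)

/-- The set `A(f,ε)` of points `(x,h)` of the upper half-plane with `|Δ₂f(x,h)| > ε`. -/
def largeDifferenceSet (f : ℝ → ℝ) (ε : ℝ) : Set (ℝ × ℝ) :=
  {p | 0 < p.2 ∧ ε < |secondDividedDifference f p.1 p.2|}

/-- `C(f,ε) = sup_I |I|⁻¹ ∫_I ∫_0^{|I|} χ_{A(f,ε)}(x,h) dh dx / h` in `[0,∞]`, where `I = [a,b]`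
ranges over all nondegenerate finite intervals. -/
def carlesonQuantity (f : ℝ → ℝ) (ε : ℝ) : ℝ≥0∞ :=
  ⨆ (a : ℝ) (b : ℝ) (_ : a < b),
    (ENNReal.ofReal (b - a))⁻¹ *
      ∫⁻ x in Icc a b, ∫⁻ h in Ioc 0 (b - a),
        (largeDifferenceSet f ε).indicator (fun p => ENNReal.ofReal (1 / p.2)) (x, h)

/-- `inf {ε > 0 : C(f,ε) < ∞}`. -/
def criticalLevel (f : ℝ → ℝ) : ℝ≥0∞ :=
  ⨅ (ε : ℝ) (_ : 0 < ε ∧ carlesonQuantity f ε < ∞), ENNReal.ofReal ε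

end

/-! Both inequalities compare `f` with a primitive of a `BMO` function through Carleson measures.

If `g` is a primitive of `φ` in `BMO`, then `Δ₂g(x,h)` is the difference of the means of `φ` over
the two halves of `[x-h, x+h]`. Hence `(Δ₂g)²/4` is exactly the drop in variance when the interval
is halved (`primitiveVariance_eq_half_add`). Integrated in `dx dh/h`, these drops telescope, so
`(Δ₂g)² dx dh/h` is a Carleson measure. By Chebyshev, `C(g,δ)` is finite for every `δ > 0`
(`carlesonQuantity_lt_top_of_mem_IBMO`), and `f` inherits this at levels above `‖f-g‖_*`.

Conversely, `f` is a superposition of tents of width `h ≤ 2` whose coefficients for `h ≤ 1` are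
multiples of `Δ₂f` (`tentPotential_tentCoefficient`). The coefficients are cut at the level `ε`.
Coefficients bounded by `ε` produce a function of Zygmund seminorm at most `20ε`
(`IsStripCoefficient.zygmundSeminorm_tentPotential_le`). The remaining coefficients `a` make `|a| dy
dh/h` a Carleson measure when `C(f,ε) < ∞`, and their superposition lies in `I(BMO)`
(`IsStripCoefficient.tentPotential_mem_IBMO`). For the latter, the derivative on an interval is
split at the height equal to its length: the low part is controlled in `L²` by an area function
(`lintegral_sq_truncatedArea_le`), and the high part is Lipschitz at that scale. Compact support of
`f` serves to bound the coefficients with `1 < h ≤ 2`, which involve `f` itself. -/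

/-! ### Distributional derivatives and primitives. -/

theorem HasCompactSupport.exists_support_subset_Ioo {η : ℝ → ℝ} (h : HasCompactSupport η) :
    ∃ R : ℝ, 0 < R ∧ tsupport η ⊆ Ioo (-R) R := by
  obtain ⟨R, hR, hs⟩ := h.isCompact.isBounded.subset_ball_lt 0 0
  refine ⟨R, hR, fun x hx => ?_⟩
  have := hs hx
  rw [Real.ball_eq_Ioo] at this
  simpa using this

theorem integral_eq_intervalIntegral_of_support {F : ℝ → ℝ} {R : ℝ} (hR : 0 < R)
    (h : ∀ x, F x ≠ 0 → x ∈ Ioo (-R) R) : ∫ x, F x = ∫ x in (-R)..R, F x := by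
  rw [intervalIntegral.integral_of_le (by linarith)]
  refine (setIntegral_eq_integral_of_forall_compl_eq_zero fun x hx => ?_).symm
  by_contra h0
  exact hx (Ioo_subset_Ioc_self (h x h0))

theorem locallyIntegrable_intervalIntegrable {φ : ℝ → ℝ} (hφ : LocallyIntegrable φ volume)
    (a b : ℝ) : IntervalIntegrable φ volume a b :=
  (hφ.integrableOn_isCompact isCompact_uIcc).intervalIntegrable

/-- Integration by parts for absolutely continuous functions, with Lebesgue differentiation
identifying `deriv g` with `φ` almost everywhere. -/
theorem isDistributionalDeriv_of_primitive {g φ : ℝ → ℝ} (hφ : LocallyIntegrable φ volume)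
    (hg : ∀ x, g x = g 0 + ∫ t in (0 : ℝ)..x, φ t) : IsDistributionalDeriv g φ := by
  intro η hη hc
  obtain ⟨R, hR, hs⟩ := hc.exists_support_subset_Ioo
  have hint : ∀ a b, IntervalIntegrable φ volume a b := locallyIntegrable_intervalIntegrable hφ
  have hac : AbsolutelyContinuousOnInterval g (-R) R := by
    have h1 := (hint (-R) R).absolutelyContinuousOnInterval_intervalIntegral
      (c := 0) (by rw [uIcc_of_le (by linarith)]; constructor <;> linarith)
    have h2 : AbsolutelyContinuousOnInterval (fun _ : ℝ => g 0) (-R) R :=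
      (contDiff_const (n := 1)).contDiffOn.absolutelyContinuousOnInterval
    have : g = (fun _ : ℝ => g 0) + fun x => ∫ t in (0 : ℝ)..x, φ t := by
      ext x; exact hg x
    rw [this]
    exact h2.add h1
  have hacη : AbsolutelyContinuousOnInterval η (-R) R :=
    (hη.of_le (m := 1) (by exact_mod_cast le_top)).contDiffOn.absolutelyContinuousOnInterval
  have hz : ∀ x, x ∉ Ioo (-R) R → η x = 0 := fun x hx => by
    by_contra h0
    exact hx (hs (subset_tsupport _ h0))
  rw [integral_eq_intervalIntegral_of_support hR, integral_eq_intervalIntegral_of_support hR,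
    hac.integral_mul_deriv_eq_deriv_mul hacη, hz R (by simp), hz (-R) (by simp)]
  · have : ∫ x in (-R)..R, deriv g x * η x = ∫ x in (-R)..R, φ x * η x := by
      apply intervalIntegral.integral_congr_ae
      filter_upwards [(hint (-R) R).ae_hasDerivAt_integral] with x hx hxm
      have h1 := hx (uIoc_subset_uIcc hxm) 0 (by
        rw [uIcc_of_le (by linarith)]; constructor <;> linarith)
      have h2 : HasDerivAt g (φ x) x := by
        have : g = fun x => g 0 + ∫ t in (0 : ℝ)..x, φ t := funext hg
        rw [this]
        exact h1.const_add _
      rw [h2.deriv]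
    rw [this]
    simp
  · intro x hx
    by_contra h0
    exact hx (by simp [hz x h0])
  · intro x hx
    by_contra h0
    have : deriv η x = 0 := by
      by_contra h1
      exact h0 (hs (support_deriv_subset h1))
    exact hx (by simp [this])

/-- The moving integral of `ζ` over `[x-t, x]` serves as `η`. It supplies the test functions that
detect translation invariance. -/
theorem contDiff_hasCompactSupport_moving_integral {ζ : ℝ → ℝ} (hζ : ContDiff ℝ (⊤ : ℕ∞) ζ)
    (hc : HasCompactSupport ζ) (t : ℝ) :
    ∃ η : ℝ → ℝ, ContDiff ℝ (⊤ : ℕ∞) η ∧ HasCompactSupport η ∧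
      deriv η = fun x => ζ x - ζ (x - t) := by
  have hcont := hζ.continuous
  have hd : ∀ x, HasDerivAt (fun x => ∫ y in (x - t)..x, ζ y) (ζ x - ζ (x - t)) x := by
    intro x
    have key : (fun x => ∫ y in (x - t)..x, ζ y) =
        fun x => (∫ y in (0 : ℝ)..x, ζ y) - ∫ y in (0 : ℝ)..(x - t), ζ y := by
      ext x
      rw [intervalIntegral.integral_interval_sub_left] <;> exact hcont.intervalIntegrable _ _
    rw [key]
    have h1 := fun x => intervalIntegral.integral_hasDerivAt_right
      (hcont.intervalIntegrable 0 x) hcont.aestronglyMeasurable.stronglyMeasurableAtFilter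
      hcont.continuousAt
    exact (h1 x).sub ((h1 (x - t)).comp_sub_const x t)
  have hderiv : deriv (fun x => ∫ y in (x - t)..x, ζ y) = fun x => ζ x - ζ (x - t) :=
    funext fun x => (hd x).deriv
  refine ⟨_, ?_, ?_, hderiv⟩
  · refine contDiff_infty_iff_deriv.2 ⟨fun x => (hd x).differentiableAt, ?_⟩
    rw [hderiv]
    exact hζ.sub (hζ.comp (contDiff_id.sub contDiff_const))
  · obtain ⟨R, hR, hs⟩ := hc.exists_support_subset_Ioo
    refine HasCompactSupport.intro (isCompact_Icc (a := -R - |t|) (b := R + |t|)) fun x hx => ?_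
    refine intervalIntegral.integral_zero_ae (Filter.Eventually.of_forall fun y hy => ?_)
    by_contra h0
    have h1 := hs (subset_tsupport _ h0)
    apply hx
    rw [mem_uIoc] at hy
    rcases abs_cases t with ⟨h, _⟩ | ⟨h, _⟩ <;> rw [h] <;> rcases hy with hy | hy <;>
      constructor <;> linarith [h1.1, h1.2, hy.1, hy.2]

/-- Testing against `ζ - ζ(· - t)` shows that `u(· + t) - u` annihilates every test function, so `u`
is invariant under all translations. -/
theorem eq_of_isDistributionalDeriv_zero {u : ℝ → ℝ} (hu : Continuous u)
    (h : IsDistributionalDeriv u 0) (x y : ℝ) : u x = u y := by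
  suffices key : ∀ t x, u (x + t) = u x by
    have := key (x - y) y
    rwa [add_sub_cancel] at this
  intro t
  have hv : Continuous fun x => u (x + t) - u x := by fun_prop
  have hae : ∀ᵐ x ∂(volume : Measure ℝ), (fun x => u (x + t) - u x) x = 0 := by
    refine ae_eq_zero_of_integral_contDiff_smul_eq_zero hv.locallyIntegrable fun ζ hζ hc => ?_
    obtain ⟨η, hη, hcη, hd⟩ := contDiff_hasCompactSupport_moving_integral hζ hc t
    have h0 := h η hη hcη
    rw [hd] at h0
    have i1 : Integrable fun x => u x * ζ x :=
      (hu.mul hζ.continuous).integrable_of_hasCompactSupport hc.mul_left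
    have i2 : Integrable fun x => u (x + t) * ζ x :=
      ((hu.comp (continuous_add_const t)).mul hζ.continuous).integrable_of_hasCompactSupport
        hc.mul_left
    have i3 : Integrable fun x => u x * ζ (x - t) := by
      have := i2.comp_sub_right t
      simpa using this
    have e1 : ∫ x, u x * ζ (x - t) = ∫ x, u (x + t) * ζ x := by
      rw [← integral_sub_right_eq_self (fun x => u (x + t) * ζ x) t]
      simp
    have e2 : ∫ x, u x * (ζ x - ζ (x - t)) = (∫ x, u x * ζ x) - ∫ x, u (x + t) * ζ x := by
      simp_rw [mul_sub]
      rw [integral_sub i1 i3, e1]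
    have e3 : ∫ x, ζ x • (u (x + t) - u x) = (∫ x, u (x + t) * ζ x) - ∫ x, u x * ζ x := by
      rw [← integral_sub i2 i1]
      congr 1
      ext x
      simp only [smul_eq_mul]
      ring
    rw [e3]
    rw [e2] at h0
    simp at h0
    linarith
  have := (hv.ae_eq_iff_eq volume continuous_const).1 hae
  intro x
  exact sub_eq_zero.1 (congrFun this x)

theorem sub_eq_integral_of_isDistributionalDeriv {g φ : ℝ → ℝ} (hg : Continuous g)
    (hφ : LocallyIntegrable φ volume) (h : IsDistributionalDeriv g φ) (x y : ℝ) :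
    g y - g x = ∫ t in x..y, φ t := by
  have hint : ∀ a b, IntervalIntegrable φ volume a b := locallyIntegrable_intervalIntegrable hφ
  set P : ℝ → ℝ := fun x => ∫ t in (0 : ℝ)..x, φ t with hP
  have hPc : Continuous P := intervalIntegral.continuous_primitive hint 0
  have hPd : IsDistributionalDeriv P φ :=
    isDistributionalDeriv_of_primitive hφ fun x => by simp [hP]
  have hz : IsDistributionalDeriv (g - P) 0 := by
    intro η hη hc
    have hdc : Continuous (deriv η) := hη.continuous_deriv (by exact_mod_cast le_top)
    have i1 : Integrable fun x => g x * deriv η x :=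
      (hg.mul hdc).integrable_of_hasCompactSupport hc.deriv.mul_left
    have i2 : Integrable fun x => P x * deriv η x :=
      (hPc.mul hdc).integrable_of_hasCompactSupport hc.deriv.mul_left
    simp only [Pi.sub_apply, Pi.zero_apply, sub_mul, zero_mul]
    rw [integral_sub i1 i2, h η hη hc, hPd η hη hc]
    simp
  have := eq_of_isDistributionalDeriv_zero (hg.sub hPc) hz x y
  have h2 : P y - P x = ∫ t in x..y, φ t :=
    intervalIntegral.integral_interval_sub_left (hint _ _) (hint _ _)
  simp only [Pi.sub_apply] at this
  linarith

/-! ### The square function estimate for primitives of `BMO` functions. -/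

/-- If `Φ` and `Ψ` are primitives of `φ` and `φ ^ 2`, this is the variance of `φ` on
`[x - h, x + h]`. -/
noncomputable def primitiveVariance (Φ Ψ : ℝ → ℝ) (x h : ℝ) : ℝ :=
  (Ψ (x + h) - Ψ (x - h)) / (2 * h) - ((Φ (x + h) - Φ (x - h)) / (2 * h)) ^ 2

/-- The variance over a union of two equal intervals is the mean of the two variances plus the
square of half the difference of the two means; that difference is `Δ₂Φ(x,h)`. -/
theorem primitiveVariance_eq_half_add (Φ Ψ : ℝ → ℝ) (x : ℝ) {h : ℝ} (hh : 0 < h) :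
    primitiveVariance Φ Ψ x h =
      (primitiveVariance Φ Ψ (x - h / 2) (h / 2) + primitiveVariance Φ Ψ (x + h / 2) (h / 2)) / 2 +
        secondDividedDifference Φ x h ^ 2 / 4 := by
  have e1 : x - h / 2 + h / 2 = x := by ring
  have e2 : x - h / 2 - h / 2 = x - h := by ring
  have e3 : x + h / 2 + h / 2 = x + h := by ring
  have e4 : x + h / 2 - h / 2 = x := by ring
  simp only [primitiveVariance, secondDividedDifference, e1, e2, e3, e4]
  field_simp
  ring

theorem continuous_primitiveVariance_exp {Φ Ψ : ℝ → ℝ} (hΦ : Continuous Φ) (hΨ : Continuous Ψ) :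
    Continuous fun p : ℝ × ℝ => primitiveVariance Φ Ψ p.2 (Real.exp p.1) := by
  unfold primitiveVariance
  fun_prop (disch := intro x; positivity)

theorem continuous_secondDividedDifference_exp {Φ : ℝ → ℝ} (hΦ : Continuous Φ) :
    Continuous fun p : ℝ × ℝ => secondDividedDifference Φ p.2 (Real.exp p.1) := by
  unfold secondDividedDifference
  fun_prop (disch := intro x; positivity)

/-- Shifting the window loses a piece of length `s`, where `W ≤ B`, and gains a piece where `W ≥ 0`.
-/
theorem intervalIntegral_shift_ge {W : ℝ → ℝ} (hW : Continuous W) {B : ℝ}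
    (h0 : ∀ x, 0 ≤ W x) (hB : ∀ x, W x ≤ B) (a b : ℝ) {s : ℝ} (hs : 0 ≤ s) :
    (∫ x in a..b, W x) - s * B ≤ ∫ x in a..b, W (x - s) ∧
      (∫ x in a..b, W x) - s * B ≤ ∫ x in a..b, W (x + s) := by
  have hi : ∀ u v, IntervalIntegrable W volume u v := fun u v => hW.intervalIntegrable u v
  have lo : ∀ u, 0 ≤ ∫ x in u..(u + s), W x := fun u =>
    intervalIntegral.integral_nonneg (by linarith) fun x _ => h0 x
  have up : ∀ u, ∫ x in u..(u + s), W x ≤ s * B := fun u => by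
    have := intervalIntegral.integral_mono_on (a := u) (b := u + s) (by linarith) (hi _ _)
      (intervalIntegrable_const (c := B)) fun x _ => hB x
    simpa using this
  rw [intervalIntegral.integral_comp_sub_right, intervalIntegral.integral_comp_add_right]
  constructor
  · have e1 := intervalIntegral.integral_add_adjacent_intervals (hi (a - s) a) (hi a b)
    have e2 := intervalIntegral.integral_add_adjacent_intervals (hi (a - s) (b - s)) (hi (b - s) b)
    have h1 := lo (a - s)
    have h2 := up (b - s)
    rw [sub_add_cancel] at h1 h2
    linarith
  · have e1 := intervalIntegral.integral_add_adjacent_intervals (hi a (a + s)) (hi (a + s) (b + s))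
    have e2 := intervalIntegral.integral_add_adjacent_intervals (hi a b) (hi b (b + s))
    linarith [up a, lo b]

/-- The variance identity integrated in `x`. Each half is centred at distance `exp t / 2` from `x`,
and undoing the two shifts costs `2 * 2 * (exp t / 2) * B`. -/
theorem integral_sq_secondDividedDifference_le {Φ Ψ : ℝ → ℝ} (hΦ : Continuous Φ)
    (hΨ : Continuous Ψ) {B : ℝ} (h0 : ∀ x h, 0 < h → 0 ≤ primitiveVariance Φ Ψ x h)
    (hB : ∀ x h, 0 < h → primitiveVariance Φ Ψ x h ≤ B) (a b t : ℝ) :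
    ∫ x in a..b, secondDividedDifference Φ x (Real.exp t) ^ 2 ≤
      4 * ((∫ x in a..b, primitiveVariance Φ Ψ x (Real.exp t)) -
        ∫ x in a..b, primitiveVariance Φ Ψ x (Real.exp (t - Real.log 2))) +
          2 * B * Real.exp t := by
  have hp := Real.exp_pos t
  have he : Real.exp (t - Real.log 2) = Real.exp t / 2 := by
    rw [Real.exp_sub, Real.exp_log two_pos]
  have hVc : ∀ t, Continuous fun x => primitiveVariance Φ Ψ x (Real.exp t) := fun t =>
    (continuous_primitiveVariance_exp hΦ hΨ).comp (by fun_prop : Continuous fun x : ℝ => (t, x))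
  have hW := hVc (t - Real.log 2)
  have hs := intervalIntegral_shift_ge hW (fun x => h0 _ _ (Real.exp_pos _))
    (fun x => hB _ _ (Real.exp_pos _)) a b (s := Real.exp t / 2) (by positivity)
  have key : ∀ x, secondDividedDifference Φ x (Real.exp t) ^ 2 =
      4 * primitiveVariance Φ Ψ x (Real.exp t) -
        2 * (primitiveVariance Φ Ψ (x - Real.exp t / 2) (Real.exp (t - Real.log 2)) +
          primitiveVariance Φ Ψ (x + Real.exp t / 2) (Real.exp (t - Real.log 2))) := fun x => by
    rw [primitiveVariance_eq_half_add Φ Ψ x hp, he]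
    ring
  have c1 : Continuous fun x =>
      primitiveVariance Φ Ψ (x - Real.exp t / 2) (Real.exp (t - Real.log 2)) :=
    hW.comp (continuous_sub_right _)
  have c2 : Continuous fun x =>
      primitiveVariance Φ Ψ (x + Real.exp t / 2) (Real.exp (t - Real.log 2)) :=
    hW.comp (continuous_add_const _)
  have i0 := ((hVc t).const_mul 4).intervalIntegrable (μ := volume) a b
  have i1 := c1.intervalIntegrable (μ := volume) a b
  have i2 := c2.intervalIntegrable (μ := volume) a b
  simp_rw [key]
  rw [intervalIntegral.integral_sub i0 ((i1.add i2).const_mul 2),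
    intervalIntegral.integral_const_mul, intervalIntegral.integral_const_mul,
    intervalIntegral.integral_add i1 i2]
  linarith [hs.1, hs.2]

/-- In the variable `t = log h`, halving is a shift by `log 2`, so the integral of `F t - F (t - log
2)` telescopes to at most the integral of `F` over one top window of length `log 2 ≤ 1`. This gives
`4B(b-a)`; the shift errors integrate to at most `2B(b-a)`. The bound does not depend on the cutoff
`s`. -/
theorem integral_integral_sq_secondDividedDifference_le {Φ Ψ : ℝ → ℝ} (hΦ : Continuous Φ)
    (hΨ : Continuous Ψ) {B : ℝ} (h0 : ∀ x h, 0 < h → 0 ≤ primitiveVariance Φ Ψ x h)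
    (hB : ∀ x h, 0 < h → primitiveVariance Φ Ψ x h ≤ B) {a b : ℝ} (hab : a < b)
    {s : ℝ} (hs : s ≤ Real.log (b - a)) :
    ∫ t in s..Real.log (b - a), ∫ x in a..b, secondDividedDifference Φ x (Real.exp t) ^ 2 ≤
      6 * B * (b - a) := by
  set F : ℝ → ℝ := fun t => ∫ x in a..b, primitiveVariance Φ Ψ x (Real.exp t) with hF
  have hFc : Continuous F := intervalIntegral.continuous_parametric_intervalIntegral_of_continuous'
    (f := fun t x => primitiveVariance Φ Ψ x (Real.exp t))
    (continuous_primitiveVariance_exp hΦ hΨ) a b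
  have hDc : Continuous fun t => ∫ x in a..b, secondDividedDifference Φ x (Real.exp t) ^ 2 :=
    intervalIntegral.continuous_parametric_intervalIntegral_of_continuous'
      (f := fun t x => secondDividedDifference Φ x (Real.exp t) ^ 2)
      ((continuous_secondDividedDifference_exp hΦ).fun_pow 2) a b
  have hVc : ∀ t, Continuous fun x => primitiveVariance Φ Ψ x (Real.exp t) := fun t =>
    (continuous_primitiveVariance_exp hΦ hΨ).comp (by fun_prop : Continuous fun x : ℝ => (t, x))
  have hB0 : 0 ≤ B := (h0 0 1 one_pos).trans (hB 0 1 one_pos)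
  have hF0 : ∀ t, 0 ≤ F t := fun t =>
    intervalIntegral.integral_nonneg hab.le fun x _ => h0 _ _ (Real.exp_pos _)
  have hFB : ∀ t, F t ≤ (b - a) * B := by
    intro t
    have := intervalIntegral.integral_mono_on (μ := volume) hab.le ((hVc t).intervalIntegrable a b)
      (intervalIntegrable_const (c := B)) fun x _ => hB x _ (Real.exp_pos t)
    rwa [intervalIntegral.integral_const, smul_eq_mul] at this
  have hi : ∀ u v, IntervalIntegrable F volume u v := fun u v => hFc.intervalIntegrable u v
  have hsub : Continuous fun t => F (t - Real.log 2) := hFc.comp (continuous_sub_right _)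
  have hm := intervalIntegral.integral_mono_on (μ := volume) hs (hDc.intervalIntegrable _ _)
    (Continuous.intervalIntegrable (by fun_prop) _ _ :
      IntervalIntegrable (fun t => 4 * (F t - F (t - Real.log 2)) + 2 * B * Real.exp t) volume _ _)
    fun t _ => integral_sq_secondDividedDifference_le hΦ hΨ h0 hB a b t
  refine hm.trans ?_
  rw [intervalIntegral.integral_add (Continuous.intervalIntegrable (by fun_prop) _ _)
    (Continuous.intervalIntegrable (by fun_prop) _ _), intervalIntegral.integral_const_mul,
    intervalIntegral.integral_const_mul, intervalIntegral.integral_sub (hi _ _)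
    (hsub.intervalIntegrable _ _), intervalIntegral.integral_comp_sub_right, integral_exp,
    Real.exp_log (sub_pos.2 hab)]
  set T := Real.log (b - a)
  have e1 := intervalIntegral.integral_add_adjacent_intervals
    (hi (s - Real.log 2) (T - Real.log 2)) (hi (T - Real.log 2) T)
  have e2 := intervalIntegral.integral_add_adjacent_intervals (hi (s - Real.log 2) s) (hi s T)
  have hl := Real.log_pos one_lt_two
  have hl1 : Real.log 2 ≤ 1 := by have := Real.log_two_lt_d9; linarith
  have l1 : 0 ≤ ∫ t in (s - Real.log 2)..s, F t :=
    intervalIntegral.integral_nonneg (by linarith) fun x _ => hF0 x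
  have l2 : ∫ t in (T - Real.log 2)..T, F t ≤ Real.log 2 * ((b - a) * B) := by
    have := intervalIntegral.integral_mono_on (a := T - Real.log 2) (b := T) (by linarith) (hi _ _)
      (intervalIntegrable_const (c := (b - a) * B)) fun x _ => hFB x
    rwa [intervalIntegral.integral_const, smul_eq_mul, sub_sub_cancel] at this
  have l3 : Real.log 2 * ((b - a) * B) ≤ 1 * ((b - a) * B) :=
    mul_le_mul_of_nonneg_right hl1 (mul_nonneg (sub_pos.2 hab).le hB0)
  have l4 : 0 ≤ B * Real.exp s := by positivity
  nlinarith [l1, l2, l3, l4]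

/-- The substitution `h = exp t`, which turns `dh/h` into `dt`. -/
theorem lintegral_Ioc_zero_eq_lintegral_Iic_log {L : ℝ} (hL : 0 < L) (G : ℝ → ℝ≥0∞) :
    ∫⁻ h in Ioc 0 L, G h = ∫⁻ t in Iic (Real.log L), ENNReal.ofReal (Real.exp t) *
      G (Real.exp t) := by
  have him : Real.exp '' Iic (Real.log L) = Ioc 0 L := by
    ext h
    constructor
    · rintro ⟨t, ht, rfl⟩
      exact ⟨Real.exp_pos t, (Real.le_log_iff_exp_le hL).1 ht⟩
    · rintro ⟨h0, h1⟩
      exact ⟨Real.log h, Real.log_le_log h0 h1, Real.exp_log h0⟩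
  rw [← him, lintegral_image_eq_lintegral_abs_deriv_mul measurableSet_Iic
    (fun t _ => (Real.hasDerivAt_exp t).hasDerivWithinAt) Real.exp_injective.injOn]
  simp_rw [abs_of_pos (Real.exp_pos _)]

theorem setLIntegral_Iic_ofReal_le {D : ℝ → ℝ} (hD : Continuous D) (h0 : ∀ t, 0 ≤ D t) {T c : ℝ}
    (h : ∀ s ≤ T, ∫ t in s..T, D t ≤ c) :
    ∫⁻ t in Iic T, ENNReal.ofReal (D t) ≤ ENNReal.ofReal c := by
  have hcov : AECover (volume.restrict (Iic T)) Filter.atTop fun n : ℕ => Ioi (-(n : ℝ)) :=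
    (aecover_Ioi (Filter.tendsto_neg_atTop_atBot.comp tendsto_natCast_atTop_atTop)).restrict
  refine le_of_tendsto (hcov.lintegral_tendsto_of_countably_generated
    (hD.measurable.ennreal_ofReal.aemeasurable)) ?_
  have : ∀ᶠ n : ℕ in Filter.atTop, -(n : ℝ) ≤ T :=
    (Filter.tendsto_neg_atTop_atBot.comp tendsto_natCast_atTop_atTop).eventually
      (Filter.eventually_le_atBot T)
  filter_upwards [this] with n hn
  rw [Measure.restrict_restrict measurableSet_Ioi, Ioi_inter_Iic,
    ← ofReal_integral_eq_lintegral_ofReal (hD.integrableOn_Ioc) (ae_of_all _ h0),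
    ← intervalIntegral.integral_of_le hn]
  exact ENNReal.ofReal_le_ofReal (h _ hn)

/-- Chebyshev's inequality: on the large set, `1 ≤ (Δ₂Φ)²/δ²`. -/
theorem lintegral_indicator_largeDifferenceSet_le {Φ Ψ : ℝ → ℝ} (hΦ : Continuous Φ)
    (hΨ : Continuous Ψ) {B : ℝ} (h0 : ∀ x h, 0 < h → 0 ≤ primitiveVariance Φ Ψ x h)
    (hB : ∀ x h, 0 < h → primitiveVariance Φ Ψ x h ≤ B) {a b : ℝ} (hab : a < b) {δ : ℝ}
    (hδ : 0 < δ) :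
    ∫⁻ x in Icc a b, ∫⁻ h in Ioc 0 (b - a),
        (largeDifferenceSet Φ δ).indicator (fun p => ENNReal.ofReal (1 / p.2)) (x, h) ≤
      ENNReal.ofReal (6 * B / δ ^ 2) * ENNReal.ofReal (b - a) := by
  have hb := sub_pos.2 hab
  have hB0 : 0 ≤ B := (h0 0 1 one_pos).trans (hB 0 1 one_pos)
  have hdc := (continuous_secondDividedDifference_exp hΦ).fun_pow 2
  have step : ∀ x, ∫⁻ h in Ioc 0 (b - a),
      (largeDifferenceSet Φ δ).indicator (fun p => ENNReal.ofReal (1 / p.2)) (x, h) ≤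
      ∫⁻ t in Iic (Real.log (b - a)),
        ENNReal.ofReal (secondDividedDifference Φ x (Real.exp t) ^ 2 / δ ^ 2) := fun x => by
    rw [lintegral_Ioc_zero_eq_lintegral_Iic_log hb]
    refine lintegral_mono fun t => ?_
    have hp := Real.exp_pos t
    by_cases hm : (x, Real.exp t) ∈ largeDifferenceSet Φ δ
    · rw [indicator_of_mem hm, ← ENNReal.ofReal_mul hp.le]
      refine ENNReal.ofReal_le_ofReal ?_
      have h1 : δ < |secondDividedDifference Φ x (Real.exp t)| := hm.2
      rw [mul_one_div_cancel hp.ne', le_div_iff₀ (by positivity), one_mul, sq_le_sq,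
        abs_of_pos hδ]
      exact h1.le
    · rw [indicator_of_notMem hm, mul_zero]
      exact zero_le
  have hDc : Continuous fun t => ∫ x in a..b, secondDividedDifference Φ x (Real.exp t) ^ 2 / δ ^ 2 :=
    intervalIntegral.continuous_parametric_intervalIntegral_of_continuous'
      (f := fun t x => secondDividedDifference Φ x (Real.exp t) ^ 2 / δ ^ 2)
      (hdc.div_const _) a b
  calc _ ≤ ∫⁻ x in Icc a b, ∫⁻ t in Iic (Real.log (b - a)),
        ENNReal.ofReal (secondDividedDifference Φ x (Real.exp t) ^ 2 / δ ^ 2) := lintegral_mono step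
    _ = ∫⁻ t in Iic (Real.log (b - a)), ∫⁻ x in Icc a b,
        ENNReal.ofReal (secondDividedDifference Φ x (Real.exp t) ^ 2 / δ ^ 2) := by
      refine lintegral_lintegral_swap (Measurable.aemeasurable ?_)
      exact ((hdc.comp continuous_swap).div_const _).measurable.ennreal_ofReal
    _ = ∫⁻ t in Iic (Real.log (b - a)), ENNReal.ofReal
        (∫ x in a..b, secondDividedDifference Φ x (Real.exp t) ^ 2 / δ ^ 2) := by
      refine lintegral_congr fun t => ?_
      have hc : Continuous fun x => secondDividedDifference Φ x (Real.exp t) ^ 2 / δ ^ 2 :=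
        (hdc.comp (by fun_prop : Continuous fun x : ℝ => (t, x))).div_const _
      rw [intervalIntegral.integral_of_le hab.le, ← integral_Icc_eq_integral_Ioc,
        ofReal_integral_eq_lintegral_ofReal hc.integrableOn_Icc
          (ae_of_all _ fun x => by positivity)]
    _ ≤ ENNReal.ofReal (6 * B / δ ^ 2 * (b - a)) := by
      refine setLIntegral_Iic_ofReal_le hDc (fun t =>
        intervalIntegral.integral_nonneg hab.le fun x _ => by positivity) fun s hs => ?_
      have := integral_integral_sq_secondDividedDifference_le hΦ hΨ h0 hB hab hs
      simp_rw [intervalIntegral.integral_div]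
      calc _ ≤ 6 * B * (b - a) / δ ^ 2 := by gcongr
        _ = _ := by ring
    _ = _ := ENNReal.ofReal_mul (by positivity)

theorem lintegral_sub_average_sq_le_bmoNorm (φ : ℝ → ℝ) {a b : ℝ} (hab : a < b) :
    ∫⁻ x in Icc a b, ENNReal.ofReal (|φ x - ⨍ y in Icc a b, φ y| ^ 2) ≤
      ENNReal.ofReal (b - a) * bmoNorm φ ^ 2 := by
  have hb := sub_pos.2 hab
  have h1 : ((ENNReal.ofReal (b - a))⁻¹ *
      ∫⁻ x in Icc a b, ENNReal.ofReal (|φ x - ⨍ y in Icc a b, φ y| ^ 2)) ^ (1 / 2 : ℝ) ≤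
      bmoNorm φ :=
    le_iSup_of_le a (le_iSup_of_le b (le_iSup_of_le hab le_rfl))
  have h2 := ENNReal.rpow_le_rpow h1 (by norm_num : (0 : ℝ) ≤ 2)
  rw [← ENNReal.rpow_mul, one_div, inv_mul_cancel₀ two_ne_zero, ENNReal.rpow_one,
    ENNReal.rpow_ofNat] at h2
  rwa [← ENNReal.inv_mul_le_iff (by simpa using hab) ENNReal.ofReal_ne_top]

theorem memLp_two_Icc_of_mem_BMO {φ : ℝ → ℝ} (hφ : φ ∈ BMO) {a b : ℝ} (hab : a < b) :
    MemLp (fun x => φ x - ⨍ y in Icc a b, φ y) 2 (volume.restrict (Icc a b)) := by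
  have hi := hφ.1.integrableOn_isCompact (isCompact_Icc (a := a) (b := b))
  refine (memLp_two_iff_integrable_sq (hi.aestronglyMeasurable.sub
    aestronglyMeasurable_const)).2 ⟨(hi.aestronglyMeasurable.sub aestronglyMeasurable_const).pow 2,
    ?_⟩
  rw [hasFiniteIntegral_iff_ofReal (ae_of_all _ fun x => sq_nonneg _)]
  have := lintegral_sub_average_sq_le_bmoNorm φ hab
  simp_rw [sq_abs] at this
  exact this.trans_lt (ENNReal.mul_lt_top ENNReal.ofReal_lt_top (ENNReal.pow_lt_top hφ.2))

theorem locallyIntegrable_sq_of_mem_BMO {φ : ℝ → ℝ} (hφ : φ ∈ BMO) :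
    LocallyIntegrable (fun x => φ x ^ 2) volume := by
  intro x
  refine ⟨Icc (x - 1) (x + 1), Icc_mem_nhds (by linarith) (by linarith), ?_⟩
  have h := (memLp_two_Icc_of_mem_BMO hφ (show x - 1 < x + 1 by linarith)).add
    (memLp_const (⨍ y in Icc (x - 1) (x + 1), φ y))
  refine h.integrable_sq.congr (ae_of_all _ fun y => ?_)
  simp

theorem integral_sq_sub_average {φ : ℝ → ℝ} {a b : ℝ} (hab : a < b)
    (h1 : IntegrableOn φ (Icc a b)) (h2 : IntegrableOn (fun x => φ x ^ 2) (Icc a b)) :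
    ∫ x in Icc a b, (φ x - ⨍ y in Icc a b, φ y) ^ 2 =
      (∫ x in a..b, φ x ^ 2) - (∫ x in a..b, φ x) ^ 2 / (b - a) := by
  have hb := sub_pos.2 hab
  set A := ⨍ y in Icc a b, φ y with hA
  have hA' : A * (b - a) = ∫ x in a..b, φ x := by
    rw [hA, setAverage_eq, intervalIntegral.integral_of_le hab.le,
      ← integral_Icc_eq_integral_Ioc, Measure.real, Real.volume_Icc, ENNReal.toReal_ofReal hb.le,
      smul_eq_mul]
    field_simp
  have key : ∀ x, (φ x - A) ^ 2 = φ x ^ 2 - 2 * A * φ x + A ^ 2 := fun x => by ring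
  simp_rw [key]
  have e1 : ∫ x in Icc a b, φ x = ∫ x in a..b, φ x := by
    rw [intervalIntegral.integral_of_le hab.le, integral_Icc_eq_integral_Ioc]
  have e2 : ∫ x in Icc a b, φ x ^ 2 = ∫ x in a..b, φ x ^ 2 := by
    rw [intervalIntegral.integral_of_le hab.le, integral_Icc_eq_integral_Ioc]
  have i1 : IntegrableOn (fun x => 2 * A * φ x) (Icc a b) := h1.const_mul _
  have i2 : IntegrableOn (fun x => φ x ^ 2 - 2 * A * φ x) (Icc a b) := h2.sub i1
  rw [integral_add i2 (integrable_const _), integral_sub h2 i1, integral_const_mul, integral_const,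
    measureReal_restrict_apply_univ, Measure.real,
    Real.volume_Icc, ENNReal.toReal_ofReal hb.le, e1, e2, ← hA', smul_eq_mul]
  field_simp
  ring

theorem exists_bound_primitiveVariance {φ : ℝ → ℝ} (hφ : φ ∈ BMO) :
    ∃ B : ℝ, ∀ x h, 0 < h →
      0 ≤ primitiveVariance (fun x => ∫ t in (0 : ℝ)..x, φ t)
        (fun x => ∫ t in (0 : ℝ)..x, φ t ^ 2) x h ∧
      primitiveVariance (fun x => ∫ t in (0 : ℝ)..x, φ t)
        (fun x => ∫ t in (0 : ℝ)..x, φ t ^ 2) x h ≤ B := by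
  refine ⟨(bmoNorm φ ^ 2).toReal, fun x h hh => ?_⟩
  have hab : x - h < x + h := by linarith
  have h2 := locallyIntegrable_sq_of_mem_BMO hφ
  have hi := locallyIntegrable_intervalIntegrable hφ.1
  have hi2 := locallyIntegrable_intervalIntegrable h2
  have e := integral_sq_sub_average hab (hφ.1.integrableOn_isCompact isCompact_Icc)
    (h2.integrableOn_isCompact isCompact_Icc)
  set A := ⨍ y in Icc (x - h) (x + h), φ y with hA
  have hV : primitiveVariance (fun x => ∫ t in (0 : ℝ)..x, φ t)
        (fun x => ∫ t in (0 : ℝ)..x, φ t ^ 2) x h =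
      (∫ y in Icc (x - h) (x + h), (φ y - A) ^ 2) / (2 * h) := by
    rw [primitiveVariance, e, intervalIntegral.integral_interval_sub_left (hi _ _) (hi _ _),
      intervalIntegral.integral_interval_sub_left (hi2 _ _) (hi2 _ _)]
    have : x + h - (x - h) = 2 * h := by ring
    rw [this]
    field_simp
  have hle := lintegral_sub_average_sq_le_bmoNorm φ hab
  simp_rw [sq_abs] at hle
  rw [← hA, ← ofReal_integral_eq_lintegral_ofReal
    (memLp_two_Icc_of_mem_BMO hφ hab).integrable_sq (ae_of_all _ fun y => sq_nonneg _)] at hle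
  have hfin : bmoNorm φ ^ 2 ≠ ∞ := (ENNReal.pow_lt_top hφ.2).ne
  have h0 : 0 ≤ ∫ y in Icc (x - h) (x + h), (φ y - A) ^ 2 :=
    integral_nonneg fun y => sq_nonneg _
  rw [hV]
  refine ⟨by positivity, ?_⟩
  rw [← ENNReal.ofReal_toReal hfin, ← ENNReal.ofReal_mul (by linarith),
    ENNReal.ofReal_le_ofReal_iff (mul_nonneg (by linarith) ENNReal.toReal_nonneg)] at hle
  rw [div_le_iff₀ (by positivity)]
  linarith

/-! ### The critical level is bounded by the distance. -/

theorem secondDividedDifference_sub (f g : ℝ → ℝ) (x h : ℝ) :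
    secondDividedDifference (f - g) x h =
      secondDividedDifference f x h - secondDividedDifference g x h := by
  simp only [secondDividedDifference, Pi.sub_apply]
  ring

theorem abs_secondDividedDifference_le (f : ℝ → ℝ) (x : ℝ) {h : ℝ} (hh : 0 < h) :
    ENNReal.ofReal |secondDividedDifference f x h| ≤ zygmundSeminorm f :=
  le_iSup_of_le x (le_iSup_of_le h (le_iSup_of_le hh le_rfl))

theorem carlesonQuantity_lt_top_of_mem_IBMO {g : ℝ → ℝ} (hg : g ∈ IBMO) {δ : ℝ} (hδ : 0 < δ) :
    carlesonQuantity g δ < ∞ := by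
  obtain ⟨hgc, φ, hφ, hd⟩ := hg
  obtain ⟨B, hB⟩ := exists_bound_primitiveVariance hφ
  set Φ : ℝ → ℝ := fun x => ∫ t in (0 : ℝ)..x, φ t with hΦ
  have hΦc : Continuous Φ :=
    intervalIntegral.continuous_primitive (locallyIntegrable_intervalIntegrable hφ.1) 0
  have hΨc : Continuous fun x => ∫ t in (0 : ℝ)..x, φ t ^ 2 :=
    intervalIntegral.continuous_primitive
      (locallyIntegrable_intervalIntegrable (locallyIntegrable_sq_of_mem_BMO hφ)) 0
  have hgΦ : ∀ x, g x = g 0 + Φ x := fun x => by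
    rw [hΦ]
    dsimp only
    rw [← sub_eq_integral_of_isDistributionalDeriv hgc hφ.1 hd]
    ring
  -- Second differences do not see the additive constant `g 0`.
  have hset : largeDifferenceSet g δ = largeDifferenceSet Φ δ := by
    have : ∀ x h, secondDividedDifference g x h = secondDividedDifference Φ x h := fun x h => by
      rw [secondDividedDifference, hgΦ, hgΦ x, hgΦ (x - h), secondDividedDifference]
      ring
    simp only [largeDifferenceSet, this]
  refine lt_of_le_of_lt (b := ENNReal.ofReal (6 * B / δ ^ 2)) ?_ ENNReal.ofReal_lt_top
  refine iSup_le fun a => iSup_le fun b => iSup_le fun hab => ?_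
  rw [ENNReal.inv_mul_le_iff (by simpa using hab) ENNReal.ofReal_ne_top, hset, mul_comm]
  exact lintegral_indicator_largeDifferenceSet_le hΦc hΨc (fun x h hh => (hB x h hh).1)
    (fun x h hh => (hB x h hh).2) hab hδ

theorem carlesonQuantity_mono {f g : ℝ → ℝ} {ε δ : ℝ}
    (h : largeDifferenceSet f ε ⊆ largeDifferenceSet g δ) :
    carlesonQuantity f ε ≤ carlesonQuantity g δ := by
  refine iSup_mono fun a => iSup_mono fun b => iSup_mono fun _ => ?_
  gcongr

theorem criticalLevel_le_two_mul_distIBMO (f : ℝ → ℝ) : criticalLevel f ≤ 2 * distIBMO f := by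
  rw [distIBMO, ENNReal.mul_iInf_of_ne two_ne_zero ENNReal.ofNat_ne_top]
  refine le_iInf fun g => ?_
  rw [ENNReal.mul_iInf_of_ne two_ne_zero ENNReal.ofNat_ne_top]
  refine le_iInf fun hg => ?_
  rcases eq_or_ne (zygmundSeminorm (f - g)) ∞ with htop | hfin
  · rw [htop, ENNReal.mul_top two_ne_zero]
    exact le_top
  set d := (zygmundSeminorm (f - g)).toReal with hd
  have hd0 : 0 ≤ d := ENNReal.toReal_nonneg
  have hdiff : ∀ x h, 0 < h → |secondDividedDifference f x h - secondDividedDifference g x h| ≤ d :=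
    fun x h hh => by
      rw [← secondDividedDifference_sub]
      have := abs_secondDividedDifference_le (f - g) x hh
      rwa [← ENNReal.ofReal_toReal hfin, ENNReal.ofReal_le_ofReal_iff hd0] at this
  refine ENNReal.le_of_forall_pos_le_add fun η hη _ => ?_
  have hη' : (0 : ℝ) < η := hη
  have hpos : 0 < 2 * d + (η : ℝ) := by positivity
  -- Where `|Δ₂f| > 2d + η`, one has `|Δ₂g| > d + η`. The term `η` keeps the levels positive when `d
  -- = 0`; the level `d + η` for `f` would work as well.
  have hC : carlesonQuantity f (2 * d + η) < ∞ := by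
    refine (carlesonQuantity_mono (g := g) (δ := d + η) ?_).trans_lt
      (carlesonQuantity_lt_top_of_mem_IBMO hg (by positivity))
    rintro ⟨x, h⟩ ⟨hh, hlt⟩
    refine ⟨hh, ?_⟩
    have h1 := hdiff x h hh
    have h2 := abs_sub_abs_le_abs_sub (secondDividedDifference f x h)
      (secondDividedDifference g x h)
    dsimp only at hlt ⊢
    linarith
  refine (iInf₂_le (2 * d + (η : ℝ)) ⟨hpos, hC⟩).trans ?_
  rw [ENNReal.ofReal_add (by positivity) hη'.le, ENNReal.ofReal_mul zero_le_two,
    ENNReal.ofReal_toReal hfin]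
  simp

/-! ### The tent function and integral bounds for its differences. -/

/-- The tent function `max (1 - |u|) 0`. -/
noncomputable def tent (u : ℝ) : ℝ := max (1 - |u|) 0

/-- The right derivative of the tent function. -/
noncomputable def tentDeriv (u : ℝ) : ℝ :=
  if u < -1 then 0 else if u < 0 then 1 else if u < 1 then -1 else 0

@[fun_prop]
theorem continuous_tent : Continuous tent := by unfold tent; fun_prop

@[fun_prop]
theorem measurable_tent : Measurable tent := continuous_tent.measurable

@[fun_prop]
theorem measurable_tentDeriv : Measurable tentDeriv :=
  Measurable.ite measurableSet_Iio measurable_const <|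
    Measurable.ite measurableSet_Iio measurable_const <|
      Measurable.ite measurableSet_Iio measurable_const measurable_const

theorem tent_nonneg (u : ℝ) : 0 ≤ tent u := le_max_right _ _

theorem tent_le_indicator (u : ℝ) : tent u ≤ (Icc (-1) 1).indicator (fun _ => (1 : ℝ)) u := by
  by_cases h : u ∈ Icc (-1 : ℝ) 1
  · rw [indicator_of_mem h]
    exact max_le (by linarith [abs_nonneg u]) zero_le_one
  · rw [indicator_of_notMem h]
    refine max_le ?_ le_rfl
    have : ¬ |u| ≤ 1 := fun h' => h (abs_le.1 h')
    linarith

theorem abs_tentDeriv_le_indicator (u : ℝ) :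
    |tentDeriv u| ≤ (Icc (-1) 1).indicator (fun _ => (1 : ℝ)) u := by
  by_cases h : u ∈ Icc (-1 : ℝ) 1
  · rw [indicator_of_mem h]
    unfold tentDeriv
    split_ifs <;> simp
  · rw [indicator_of_notMem h]
    unfold tentDeriv
    split_ifs with h1 h2 h3
    · simp
    · exact absurd ⟨by linarith, by linarith⟩ h
    · exact absurd ⟨by linarith, by linarith⟩ h
    · simp

theorem tent_of_le_neg_one {u : ℝ} (h : u ≤ -1) : tent u = 0 := by
  rw [tent, abs_of_nonpos (by linarith), max_eq_right (by linarith)]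

theorem tent_of_mem_left {u : ℝ} (h1 : -1 ≤ u) (h2 : u ≤ 0) : tent u = 1 + u := by
  rw [tent, abs_of_nonpos h2, max_eq_left (by linarith)]
  ring

theorem tent_of_mem_right {u : ℝ} (h1 : 0 ≤ u) (h2 : u ≤ 1) : tent u = 1 - u := by
  rw [tent, abs_of_nonneg h1, max_eq_left (by linarith)]

theorem tent_of_one_le {u : ℝ} (h : 1 ≤ u) : tent u = 0 := by
  rw [tent, abs_of_nonneg (by linarith), max_eq_right (by linarith)]

theorem abs_tent_sub_tent_le (u v : ℝ) : |tent u - tent v| ≤ |u - v| := by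
  have h1 : |tent u - tent v| ≤ |(1 - |u|) - (1 - |v|)| := abs_max_sub_max_le_abs _ _ _
  refine h1.trans ?_
  rw [sub_sub_sub_cancel_left, abs_sub_comm u v]
  exact abs_abs_sub_abs_le v u

theorem hasDerivWithinAt_tent (u : ℝ) : HasDerivWithinAt tent (tentDeriv u) (Ioi u) u := by
  have key : ∀ {f : ℝ → ℝ} {d c : ℝ}, HasDerivAt f d u → u < c →
      (∀ v ∈ Ico u c, tent v = f v) → HasDerivWithinAt tent d (Ioi u) u := by
    intro f d c hf hc he
    refine (hf.hasDerivWithinAt (s := Ioi u)).congr_of_eventuallyEq ?_ (he u ⟨le_rfl, hc⟩)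
    filter_upwards [Ioo_mem_nhdsGT hc] with v hv
    exact he v ⟨hv.1.le, hv.2⟩
  unfold tentDeriv
  split_ifs with h1 h2 h3
  · exact key (hasDerivAt_const u 0) h1 fun v hv => tent_of_le_neg_one hv.2.le
  · exact key ((hasDerivAt_id u).const_add 1) h2 fun v hv =>
      tent_of_mem_left (by linarith [hv.1]) hv.2.le
  · exact key ((hasDerivAt_id u).const_sub 1) h3 fun v hv =>
      tent_of_mem_right (by linarith [hv.1]) hv.2.le
  · exact key (hasDerivAt_const u 0) (lt_add_one u) fun v hv =>
      tent_of_one_le (by linarith [hv.1])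

/-- The tent is affine off its kinks `-1, 0, 1`, so its second difference vanishes unless `u` is
within `δ` of a kink; there the Lipschitz bound `2δ` applies. -/
theorem abs_tent_second_difference_le {δ : ℝ} (hδ : 0 ≤ δ) (u : ℝ) :
    |tent (u + δ) - 2 * tent u + tent (u - δ)| ≤
      2 * δ * ((Icc (-1 - δ) (-1 + δ)).indicator (fun _ => (1 : ℝ)) u +
        (Icc (-δ) δ).indicator (fun _ => (1 : ℝ)) u +
        (Icc (1 - δ) (1 + δ)).indicator (fun _ => (1 : ℝ)) u) := by
  have n1 : 0 ≤ (Icc (-1 - δ) (-1 + δ)).indicator (fun _ => (1 : ℝ)) u :=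
    indicator_nonneg (fun _ _ => zero_le_one) u
  have n2 : 0 ≤ (Icc (-δ) δ).indicator (fun _ => (1 : ℝ)) u :=
    indicator_nonneg (fun _ _ => zero_le_one) u
  have n3 : 0 ≤ (Icc (1 - δ) (1 + δ)).indicator (fun _ => (1 : ℝ)) u :=
    indicator_nonneg (fun _ _ => zero_le_one) u
  have hlip : |tent (u + δ) - 2 * tent u + tent (u - δ)| ≤ 2 * δ := by
    have e : tent (u + δ) - 2 * tent u + tent (u - δ) =
      (tent (u + δ) - tent u) + (tent (u - δ) - tent u) := by ring
    rw [e]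
    refine (abs_add_le _ _).trans ?_
    have h1 := abs_tent_sub_tent_le (u + δ) u
    have h2 := abs_tent_sub_tent_le (u - δ) u
    rw [add_sub_cancel_left, abs_of_nonneg hδ] at h1
    rw [sub_sub_cancel_left, abs_neg, abs_of_nonneg hδ] at h2
    linarith
  by_cases h1 : u ∈ Icc (-1 - δ) (-1 + δ)
  · rw [indicator_of_mem h1]
    nlinarith [mul_nonneg hδ n2, mul_nonneg hδ n3]
  by_cases h2 : u ∈ Icc (-δ) δ
  · rw [indicator_of_mem h2]
    nlinarith [mul_nonneg hδ n1, mul_nonneg hδ n3]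
  by_cases h3 : u ∈ Icc (1 - δ) (1 + δ)
  · rw [indicator_of_mem h3]
    nlinarith [mul_nonneg hδ n1, mul_nonneg hδ n2]
  have hz : tent (u + δ) - 2 * tent u + tent (u - δ) = 0 := by
    simp only [mem_Icc, not_and_or, not_le] at h1 h2 h3
    rcases h1 with h1 | h1
    · rw [tent_of_le_neg_one (by linarith), tent_of_le_neg_one (by linarith),
        tent_of_le_neg_one (by linarith)]
      ring
    rcases h2 with h2 | h2
    · rw [tent_of_mem_left (by linarith) (by linarith), tent_of_mem_left (by linarith)
        (by linarith), tent_of_mem_left (by linarith) (by linarith)]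
      ring
    rcases h3 with h3 | h3
    · rw [tent_of_mem_right (by linarith) (by linarith), tent_of_mem_right (by linarith)
        (by linarith), tent_of_mem_right (by linarith) (by linarith)]
      ring
    · rw [tent_of_one_le (by linarith), tent_of_one_le (by linarith), tent_of_one_le (by linarith)]
      ring
  rw [hz, abs_zero]
  positivity

/-- The difference is nonzero only if a jump at `-1`, `0` or `1` separates `u` from `u + d`. -/
theorem abs_tentDeriv_sub_le (u d : ℝ) :
    |tentDeriv u - tentDeriv (u + d)| ≤
      2 * ((uIcc (-1 - d) (-1)).indicator (fun _ => (1 : ℝ)) u +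
        (uIcc (-d) 0).indicator (fun _ => (1 : ℝ)) u +
        (uIcc (1 - d) 1).indicator (fun _ => (1 : ℝ)) u) := by
  have nn : ∀ s : Set ℝ, 0 ≤ s.indicator (fun _ => (1 : ℝ)) u := fun s =>
    indicator_nonneg (fun _ _ => zero_le_one) u
  have b : ∀ v, |tentDeriv v| ≤ 1 := fun v =>
    (abs_tentDeriv_le_indicator v).trans (indicator_le_self' (fun _ _ => zero_le_one) v)
  have hb : |tentDeriv u - tentDeriv (u + d)| ≤ 2 :=
    (abs_sub _ _).trans (by linarith [b u, b (u + d)])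
  by_cases h1 : u ∈ uIcc (-1 - d) (-1)
  · rw [indicator_of_mem h1]
    linarith [nn (uIcc (-d) 0), nn (uIcc (1 - d) 1)]
  by_cases h2 : u ∈ uIcc (-d) 0
  · rw [indicator_of_mem h2]
    linarith [nn (uIcc (-1 - d) (-1)), nn (uIcc (1 - d) 1)]
  by_cases h3 : u ∈ uIcc (1 - d) 1
  · rw [indicator_of_mem h3]
    linarith [nn (uIcc (-1 - d) (-1)), nn (uIcc (-d) 0)]
  have hz : tentDeriv u = tentDeriv (u + d) := by
    simp only [mem_uIcc, not_or, not_and, not_le] at h1 h2 h3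
    unfold tentDeriv
    grind
  rw [hz, sub_self, abs_zero]
  linarith [nn (uIcc (-1 - d) (-1)), nn (uIcc (-d) 0), nn (uIcc (1 - d) 1)]

theorem lintegral_comp_sub_div {G : ℝ → ℝ≥0∞} (hG : Measurable G) (x : ℝ) {h : ℝ} (hh : 0 < h) :
    ∫⁻ y, G ((x - y) / h) = ENNReal.ofReal h * ∫⁻ u, G u := by
  rw [lintegral_sub_left_eq_self (fun y => G (y / h)) x]
  have e := Real.smul_map_volume_mul_right (inv_ne_zero hh.ne')
  conv_rhs => rw [← e, lintegral_smul_measure, lintegral_map hG (measurable_mul_const _)]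
  rw [smul_eq_mul, ← mul_assoc, abs_of_pos (inv_pos.2 hh), ← ENNReal.ofReal_mul hh.le,
    mul_inv_cancel₀ hh.ne', ENNReal.ofReal_one, one_mul]
  rfl

theorem lintegral_ofReal_indicator_one {s : Set ℝ} (hs : MeasurableSet s) :
    ∫⁻ u, ENNReal.ofReal (s.indicator (fun _ => (1 : ℝ)) u) = volume s := by
  rw [← lintegral_indicator_one hs]
  congr 1
  ext u
  by_cases h : u ∈ s <;> simp [h]

theorem lintegral_ofReal_mul_three_indicators_le {F : ℝ → ℝ} {s₁ s₂ s₃ : Set ℝ} {c r : ℝ}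
    (hc : 0 ≤ c) (h₁ : MeasurableSet s₁) (h₂ : MeasurableSet s₂) (h₃ : MeasurableSet s₃)
    (v₁ : volume s₁ = ENNReal.ofReal r) (v₂ : volume s₂ = ENNReal.ofReal r)
    (v₃ : volume s₃ = ENNReal.ofReal r)
    (hF : ∀ u, F u ≤ c * (s₁.indicator (fun _ => (1 : ℝ)) u + s₂.indicator (fun _ => (1 : ℝ)) u +
      s₃.indicator (fun _ => (1 : ℝ)) u)) :
    ∫⁻ u, ENNReal.ofReal (F u) ≤ ENNReal.ofReal (3 * c * r) := by
  have nn : ∀ (s : Set ℝ) u, 0 ≤ s.indicator (fun _ => (1 : ℝ)) u := fun s u =>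
    indicator_nonneg (fun _ _ => zero_le_one) u
  have mm : ∀ {s : Set ℝ}, MeasurableSet s →
      Measurable fun u => ENNReal.ofReal (s.indicator (fun _ => (1 : ℝ)) u) := fun hs =>
    (measurable_const.indicator hs).ennreal_ofReal
  calc _ ≤ ∫⁻ u, ENNReal.ofReal c * (ENNReal.ofReal (s₁.indicator (fun _ => (1 : ℝ)) u) +
        ENNReal.ofReal (s₂.indicator (fun _ => (1 : ℝ)) u) +
        ENNReal.ofReal (s₃.indicator (fun _ => (1 : ℝ)) u)) := by
        refine lintegral_mono fun u => ?_
        rw [← ENNReal.ofReal_add (nn _ _) (nn _ _),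
          ← ENNReal.ofReal_add (add_nonneg (nn _ _) (nn _ _)) (nn _ _), ← ENNReal.ofReal_mul hc]
        exact ENNReal.ofReal_le_ofReal (hF u)
    _ = ENNReal.ofReal (3 * c * r) := by
        rw [lintegral_const_mul' _ _ ENNReal.ofReal_ne_top,
          lintegral_add_right _ (mm h₃), lintegral_add_right _ (mm h₂),
          lintegral_ofReal_indicator_one h₁, lintegral_ofReal_indicator_one h₂,
          lintegral_ofReal_indicator_one h₃, v₁, v₂, v₃,
          mul_comm 3 c, mul_assoc, ENNReal.ofReal_mul hc, ENNReal.ofReal_mul zero_le_three]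
        rw [ENNReal.ofReal_ofNat]
        ring

theorem lintegral_abs_tent_second_difference_le {δ : ℝ} (hδ : 0 ≤ δ) :
    ∫⁻ u, ENNReal.ofReal |tent (u + δ) - 2 * tent u + tent (u - δ)| ≤
      ENNReal.ofReal (12 * δ ^ 2) := by
  refine (lintegral_ofReal_mul_three_indicators_le (c := 2 * δ) (r := 2 * δ) (by positivity)
    measurableSet_Icc measurableSet_Icc measurableSet_Icc ?_ ?_ ?_
    (abs_tent_second_difference_le hδ)).trans_eq ?_
  · rw [Real.volume_Icc]; ring_nf
  · rw [Real.volume_Icc]; ring_nf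
  · rw [Real.volume_Icc]; ring_nf
  · ring_nf

theorem lintegral_abs_tentDeriv_sub_le (d : ℝ) :
    ∫⁻ u, ENNReal.ofReal |tentDeriv u - tentDeriv (u + d)| ≤ ENNReal.ofReal (6 * |d|) := by
  refine (lintegral_ofReal_mul_three_indicators_le (c := 2) (r := |d|) (by positivity)
    measurableSet_uIcc measurableSet_uIcc measurableSet_uIcc ?_ ?_ ?_
    (fun u => abs_tentDeriv_sub_le u d)).trans_eq ?_
  · rw [Real.volume_interval]; ring_nf
  · rw [Real.volume_interval]; ring_nf
  · rw [Real.volume_interval]; ring_nf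
  · ring_nf

theorem lintegral_tent_comp_le {g : ℝ → ℝ} (hg : ∀ G : ℝ → ℝ≥0∞, ∫⁻ u, G (g u) = ∫⁻ u, G u) :
    ∫⁻ u, ENNReal.ofReal (tent (g u)) ≤ 2 := by
  rw [hg fun u => ENNReal.ofReal (tent u)]
  calc _ ≤ ∫⁻ u, ENNReal.ofReal ((Icc (-1) 1).indicator (fun _ => (1 : ℝ)) u) :=
        lintegral_mono fun u => ENNReal.ofReal_le_ofReal (tent_le_indicator u)
    _ = 2 := by
        rw [lintegral_ofReal_indicator_one measurableSet_Icc, Real.volume_Icc]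
        norm_num

/-- The crude bound, used when the step exceeds the tent's width: four tents counted with
multiplicity, each of mass estimated by `2`. -/
theorem lintegral_abs_tent_second_difference_le_eight (δ : ℝ) :
    ∫⁻ u, ENNReal.ofReal |tent (u + δ) - 2 * tent u + tent (u - δ)| ≤ 8 := by
  have hm : Measurable fun u => ENNReal.ofReal (tent u) :=
    continuous_tent.measurable.ennreal_ofReal
  calc _ ≤ ∫⁻ u, (ENNReal.ofReal (tent (u + δ)) + 2 * ENNReal.ofReal (tent u) +
        ENNReal.ofReal (tent (u - δ))) := by
        refine lintegral_mono fun u => ?_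
        rw [← ENNReal.ofReal_ofNat 2, ← ENNReal.ofReal_mul zero_le_two,
          ← ENNReal.ofReal_add (tent_nonneg _) (mul_nonneg zero_le_two (tent_nonneg _)),
          ← ENNReal.ofReal_add (add_nonneg (tent_nonneg _)
            (mul_nonneg zero_le_two (tent_nonneg _))) (tent_nonneg _)]
        refine ENNReal.ofReal_le_ofReal (abs_le.2 ⟨?_, ?_⟩) <;>
          linarith [tent_nonneg (u + δ), tent_nonneg u, tent_nonneg (u - δ)]
    _ = _ := by
        rw [lintegral_add_right _ (by fun_prop), lintegral_add_right _ (by fun_prop),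
          lintegral_const_mul _ hm]
    _ ≤ 2 + 2 * 2 + 2 := by
        gcongr
        · exact lintegral_tent_comp_le fun G => lintegral_add_right_eq_self G δ
        · exact lintegral_tent_comp_le (g := id) fun G => rfl
        · exact lintegral_tent_comp_le fun G => lintegral_sub_right_eq_self G δ
    _ = 8 := by norm_num

theorem lintegral_Ioi_ofReal_div_sq {c s : ℝ} (hc : 0 ≤ c) (hs : 0 < s) :
    ∫⁻ h in Ioi s, ENNReal.ofReal (c / h ^ 2) = ENNReal.ofReal (c / s) := by
  have e : ∀ h : ℝ, h ∈ Ioi s → c / h ^ 2 = c * h ^ (-2 : ℝ) := fun h hh => by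
    have h0 : 0 < h := hs.trans hh
    rw [Real.rpow_neg h0.le, Real.rpow_two]
    rfl
  rw [setLIntegral_congr_fun measurableSet_Ioi fun h hh => by rw [e h hh],
    ← ofReal_integral_eq_lintegral_ofReal
      ((integrableOn_Ioi_rpow_of_lt (by norm_num) hs).const_mul c), integral_const_mul,
    integral_Ioi_rpow_of_lt (by norm_num) hs]
  · norm_num
    rw [Real.rpow_neg_one]
    rfl
  · filter_upwards [ae_restrict_mem measurableSet_Ioi] with h hh
    have : 0 < h := hs.trans hh
    positivity

/-! ### Tent potentials with bounded coefficients and their Zygmund seminorm. -/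

/-- The superposition of tents of width `h` centred at `y` with coefficients `a (y, h) / h`. -/
noncomputable def tentPotential (a : ℝ × ℝ → ℝ) (x : ℝ) : ℝ :=
  ∫ p : ℝ × ℝ, a p * (tent ((x - p.1) / p.2) / p.2)

/-- The formal derivative of `tentPotential a`. -/
noncomputable def tentPotentialDeriv (a : ℝ × ℝ → ℝ) (x : ℝ) : ℝ :=
  ∫ p : ℝ × ℝ, a p * (tentDeriv ((x - p.1) / p.2) / p.2 ^ 2)

/-- A bounded measurable coefficient function living in the strip `0 < h ≤ 2`. -/
structure IsStripCoefficient (a : ℝ × ℝ → ℝ) (M : ℝ) : Prop where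
  measurable : Measurable a
  abs_le : ∀ p, |a p| ≤ M
  mem_strip : ∀ p, a p ≠ 0 → p.2 ∈ Ioc (0 : ℝ) 2

theorem IsStripCoefficient.nonneg {a : ℝ × ℝ → ℝ} {M : ℝ} (ha : IsStripCoefficient a M) : 0 ≤ M :=
  (abs_nonneg _).trans (ha.abs_le 0)

theorem IsStripCoefficient.eq_zero {a : ℝ × ℝ → ℝ} {M : ℝ} (ha : IsStripCoefficient a M)
    {p : ℝ × ℝ} (hp : p.2 ∉ Ioc (0 : ℝ) 2) : a p = 0 := by
  by_contra h
  exact hp (ha.mem_strip p h)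

theorem lintegral_prod_le_of_slices {H : ℝ × ℝ → ℝ≥0∞} (hH : Measurable H) {K : ℝ → ℝ≥0∞}
    (h : ∀ t, ∫⁻ y, H (y, t) ≤ K t) : ∫⁻ p, H p ≤ ∫⁻ t, K t := by
  rw [Measure.volume_eq_prod, lintegral_prod_symm' _ hH]
  exact lintegral_mono h

/-- The kernel `G((x-y)/h)/h` has an `L¹` norm in `y` that does not depend on `h`. -/
theorem IsStripCoefficient.lintegral_slice_le {a : ℝ × ℝ → ℝ} {M : ℝ} (ha : IsStripCoefficient a M)
    {G : ℝ → ℝ} (hG : Measurable G) (x : ℝ) {h : ℝ} (hh : 0 < h) :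
    ∫⁻ y, ‖a (y, h) * (G ((x - y) / h) / h)‖ₑ ≤
      ENNReal.ofReal M * ∫⁻ u, ENNReal.ofReal |G u| := by
  have hm : Measurable fun u => ENNReal.ofReal |G u| := hG.abs.ennreal_ofReal
  calc _ ≤ ∫⁻ y, ENNReal.ofReal M * ENNReal.ofReal (1 / h) *
        (fun u => ENNReal.ofReal |G u|) ((x - y) / h) := by
        refine lintegral_mono fun y => ?_
        have h1 := ha.abs_le (y, h)
        rw [← ENNReal.ofReal_mul ha.nonneg, ← ENNReal.ofReal_mul
          (mul_nonneg ha.nonneg (by positivity)), Real.enorm_eq_ofReal_abs, abs_mul, abs_div,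
          abs_of_pos hh]
        refine ENNReal.ofReal_le_ofReal ?_
        rw [mul_assoc, one_div_mul_eq_div]
        gcongr
    _ = _ := by
        rw [lintegral_const_mul' _ _ (ENNReal.mul_ne_top ENNReal.ofReal_ne_top
          ENNReal.ofReal_ne_top), lintegral_comp_sub_div hm x hh, mul_assoc, ← mul_assoc
          (ENNReal.ofReal (1 / h)), ← ENNReal.ofReal_mul (by positivity),
          one_div_mul_cancel hh.ne', ENNReal.ofReal_one, one_mul]

theorem measurable_tent_kernel {a : ℝ × ℝ → ℝ} (ha : Measurable a) (x : ℝ) :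
    Measurable fun p : ℝ × ℝ => a p * (tent ((x - p.1) / p.2) / p.2) :=
  ha.mul ((continuous_tent.measurable.comp (by fun_prop)).div measurable_snd)

theorem measurable_tentDeriv_kernel {a : ℝ × ℝ → ℝ} (ha : Measurable a) :
    Measurable fun q : ℝ × ℝ × ℝ => a q.2 * (tentDeriv ((q.1 - q.2.1) / q.2.2) / q.2.2 ^ 2) :=
  (ha.comp measurable_snd).mul ((measurable_tentDeriv.comp (by fun_prop)).div (by fun_prop))

theorem IsStripCoefficient.integrable_tent_kernel {a : ℝ × ℝ → ℝ} {M : ℝ}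
    (ha : IsStripCoefficient a M) (x : ℝ) :
    Integrable fun p : ℝ × ℝ => a p * (tent ((x - p.1) / p.2) / p.2) := by
  have hm := measurable_tent_kernel ha.measurable x
  refine ⟨hm.aestronglyMeasurable, ?_⟩
  refine (lintegral_prod_le_of_slices hm.enorm
    (K := (Ioc 0 2).indicator fun _ => ENNReal.ofReal M * 2) fun t => ?_).trans_lt ?_
  · by_cases ht : t ∈ Ioc (0 : ℝ) 2
    · rw [indicator_of_mem ht]
      refine (ha.lintegral_slice_le continuous_tent.measurable x ht.1).trans ?_
      gcongr
      simp_rw [abs_of_nonneg (tent_nonneg _)]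
      exact lintegral_tent_comp_le (g := id) fun G => rfl
    · simp [ha.eq_zero (p := (_, t)) ht]
  · rw [lintegral_indicator measurableSet_Ioc, setLIntegral_const, Real.volume_Ioc]
    exact ENNReal.mul_lt_top (ENNReal.mul_lt_top ENNReal.ofReal_lt_top ENNReal.ofNat_lt_top)
      ENNReal.ofReal_lt_top

theorem tentPotential_add {a b : ℝ × ℝ → ℝ} {M M' : ℝ} (ha : IsStripCoefficient a M)
    (hb : IsStripCoefficient b M') (x : ℝ) :
    tentPotential (fun p => a p + b p) x = tentPotential a x + tentPotential b x := by
  simp only [tentPotential, add_mul]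
  exact integral_add (ha.integrable_tent_kernel x) (hb.integrable_tent_kernel x)

theorem IsStripCoefficient.zygmundSeminorm_tentPotential_le {b : ℝ × ℝ → ℝ} {ε : ℝ}
    (hb : IsStripCoefficient b ε) : zygmundSeminorm (tentPotential b) ≤ ENNReal.ofReal (20 * ε) := by
  refine iSup_le fun x => iSup_le fun s => iSup_le fun hs => ENNReal.ofReal_le_ofReal ?_
  have i1 := hb.integrable_tent_kernel (x + s)
  have i2 := hb.integrable_tent_kernel x
  have i3 := hb.integrable_tent_kernel (x - s)
  set D : ℝ × ℝ → ℝ := fun p => b p * ((tent ((x - p.1) / p.2 + s / p.2) -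
    2 * tent ((x - p.1) / p.2) + tent ((x - p.1) / p.2 - s / p.2)) / p.2) with hD
  have hDe : tentPotential b (x + s) - 2 * tentPotential b x + tentPotential b (x - s) =
      ∫ p, D p := by
    simp only [tentPotential]
    rw [← integral_const_mul, ← integral_sub i1 (i2.const_mul 2)]
    refine (integral_add (i1.sub (i2.const_mul 2)) i3).symm.trans ?_
    refine integral_congr_ae (ae_of_all _ fun p => ?_)
    have e1 : (x + s - p.1) / p.2 = (x - p.1) / p.2 + s / p.2 := by ring
    have e2 : (x - s - p.1) / p.2 = (x - p.1) / p.2 - s / p.2 := by ring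
    simp only [hD, Pi.sub_apply, e1, e2]
    ring
  have mt := continuous_tent.measurable
  have hDm : Measurable D := hb.measurable.mul
    ((((mt.comp (by fun_prop)).sub ((mt.comp (by fun_prop)).const_mul 2)).add
      (mt.comp (by fun_prop))).div measurable_snd)
  have hGm : ∀ δ : ℝ, Measurable fun u => tent (u + δ) - 2 * tent u + tent (u - δ) := fun δ =>
    (((mt.comp (by fun_prop)).sub (mt.const_mul 2)).add (mt.comp (by fun_prop)))
  have hle : ∫⁻ p, ‖D p‖ₑ ≤ ENNReal.ofReal (20 * ε * s) := by
    -- Heights `t ≤ s` contribute at most `8ε` each, hence `8εs`; heights `t > s` contribute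
    -- `12εs²/t²`, hence `12εs`. This is the source of `20`.
    refine (lintegral_prod_le_of_slices hDm.enorm
      (K := fun t => (Ioc 0 s).indicator (fun _ => ENNReal.ofReal ε * 8) t +
        (Ioi s).indicator (fun t => ENNReal.ofReal ε * ENNReal.ofReal (12 * s ^ 2 / t ^ 2)) t)
      fun t => ?_).trans_eq ?_
    · by_cases ht : 0 < t
      · have h0 := hb.lintegral_slice_le (hGm (s / t)) x ht
        by_cases hts : t ≤ s
        · rw [indicator_of_mem (show t ∈ Ioc 0 s from ⟨ht, hts⟩),
            indicator_of_notMem (by simpa using hts), add_zero]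
          refine h0.trans ?_
          gcongr
          exact lintegral_abs_tent_second_difference_le_eight _
        · rw [indicator_of_notMem (fun h => hts h.2),
            indicator_of_mem (show t ∈ Ioi s by simpa using hts), zero_add]
          refine h0.trans ?_
          gcongr
          refine (lintegral_abs_tent_second_difference_le (by positivity)).trans_eq ?_
          congr 1
          ring
      · have : ∀ y, b (y, t) = 0 := fun y => hb.eq_zero fun h => ht h.1
        simp [hD, this]
    · rw [lintegral_add_left (measurable_const.indicator measurableSet_Ioc),
        lintegral_indicator measurableSet_Ioc, lintegral_indicator measurableSet_Ioi,
        setLIntegral_const, lintegral_const_mul' _ _ ENNReal.ofReal_ne_top,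
        lintegral_Ioi_ofReal_div_sq (by positivity) hs, Real.volume_Ioc, mul_assoc, ← mul_add,
        ← ENNReal.ofReal_ofNat 8, ← ENNReal.ofReal_mul (by norm_num), sub_zero,
        ← ENNReal.ofReal_add (by positivity) (by positivity), ← ENNReal.ofReal_mul hb.nonneg]
      congr 1
      field_simp
      norm_num
  have hnorm : |∫ p, D p| ≤ 20 * ε * s := by
    have := (enorm_integral_le_lintegral_enorm D).trans hle
    rwa [Real.enorm_eq_ofReal_abs, ENNReal.ofReal_le_ofReal_iff
      (mul_nonneg (mul_nonneg (by norm_num) hb.nonneg) hs.le)] at this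
  rw [secondDividedDifference, hDe, abs_div, abs_of_pos hs, div_le_iff₀ hs]
  exact hnorm

/-! ### The truncated area function of a Carleson measure. -/

/-- The normalized indicator of the cone with vertex `x`. -/
noncomputable def coneKernel (x : ℝ) (p : ℝ × ℝ) : ℝ≥0∞ :=
  {q : ℝ × ℝ × ℝ | |q.1 - q.2.1| ≤ q.2.2}.indicator (fun q => ENNReal.ofReal (1 / q.2.2)) (x, p)

theorem measurable_coneKernel : Measurable fun q : ℝ × ℝ × ℝ => coneKernel q.1 q.2 :=
  Measurable.indicator (by fun_prop) (measurableSet_le (by fun_prop) (by fun_prop))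

theorem coneKernel_of_nonpos (x : ℝ) {p : ℝ × ℝ} (hp : p.2 ≤ 0) : coneKernel x p = 0 := by
  unfold coneKernel
  refine indicator_apply_eq_zero.2 fun _ => ?_
  exact ENNReal.ofReal_of_nonpos (div_nonpos_of_nonneg_of_nonpos zero_le_one hp)

theorem coneKernel_eq_indicator (x : ℝ) (p : ℝ × ℝ) :
    coneKernel x p =
      (Icc (p.1 - p.2) (p.1 + p.2)).indicator (fun _ => ENNReal.ofReal (1 / p.2)) x := by
  unfold coneKernel
  have : (x, p) ∈ {q : ℝ × ℝ × ℝ | |q.1 - q.2.1| ≤ q.2.2} ↔ x ∈ Icc (p.1 - p.2) (p.1 + p.2) := by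
    simp only [mem_ofPred_eq, mem_Icc, abs_le]
    constructor <;> rintro ⟨h1, h2⟩ <;> constructor <;> linarith
  by_cases h : x ∈ Icc (p.1 - p.2) (p.1 + p.2)
  · rw [indicator_of_mem (this.2 h), indicator_of_mem h]
  · rw [indicator_of_notMem (fun h' => h (this.1 h')), indicator_of_notMem h]

/-- The area function of `σ` truncated at height `l`. -/
noncomputable def truncatedArea (σ : Measure (ℝ × ℝ)) (l x : ℝ) : ℝ≥0∞ :=
  ∫⁻ p in {p : ℝ × ℝ | p.2 ≤ l}, coneKernel x p ∂σ

theorem measurableSet_snd_le (l : ℝ) : MeasurableSet {p : ℝ × ℝ | p.2 ≤ l} :=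
  measurableSet_le measurable_snd measurable_const

theorem measurable_truncatedArea (σ : Measure (ℝ × ℝ)) [SFinite σ] :
    Measurable fun q : ℝ × ℝ => truncatedArea σ q.1 q.2 := by
  have : ∀ q : ℝ × ℝ, truncatedArea σ q.1 q.2 =
      ∫⁻ p, {r : (ℝ × ℝ) × (ℝ × ℝ) | r.2.2 ≤ r.1.1}.indicator
        (fun r => coneKernel r.1.2 r.2) (q, p) ∂σ := fun q => by
    rw [truncatedArea, ← lintegral_indicator (measurableSet_snd_le _)]
    rfl
  simp_rw [this]
  refine Measurable.lintegral_prod_right' (f := {r : (ℝ × ℝ) × (ℝ × ℝ) | r.2.2 ≤ r.1.1}.indicator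
        (fun r => coneKernel r.1.2 r.2)) ?_
  exact (measurable_coneKernel.comp (by fun_prop : Measurable fun r : (ℝ × ℝ) × (ℝ × ℝ) =>
    (r.1.2, r.2))).indicator (measurableSet_le (by fun_prop) (by fun_prop))

/-- Fubini: a point `p` lies in the cones of exactly the `x` with `|x - p.1| ≤ p.2`, and carries the
weight `1 / p.2`. The weight `N = 1` gives the first moment of the area function, and `N p =
truncatedArea σ p.2` gives the second. -/
theorem lintegral_truncatedArea_mul_le (σ : Measure (ℝ × ℝ)) [SFinite σ] {c : ℝ≥0∞} {α β l : ℝ}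
    {N : ℝ × ℝ → ℝ → ℝ≥0∞} (hN : Measurable fun q : ℝ × ℝ × ℝ => N q.2 q.1)
    (h : ∀ p : ℝ × ℝ, 0 < p.2 → p.2 ≤ l → ∫⁻ x in Icc (p.1 - p.2) (p.1 + p.2), N p x ≤
      c * ENNReal.ofReal p.2) :
    ∫⁻ x in Icc α β, ∫⁻ p in {p : ℝ × ℝ | p.2 ≤ l}, coneKernel x p * N p x ∂σ ≤
      c * σ (Icc (α - l) (β + l) ×ˢ Iic l) := by
  have hset : MeasurableSet (Icc (α - l) (β + l) ×ˢ Iic l) := measurableSet_Icc.prod measurableSet_Iic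
  rw [lintegral_lintegral_swap (measurable_coneKernel.mul hN).aemeasurable]
  calc _ ≤ ∫⁻ p in {p : ℝ × ℝ | p.2 ≤ l},
        (Icc (α - l) (β + l) ×ˢ Iic l).indicator (fun _ => c) p ∂σ := by
        refine setLIntegral_mono (measurable_const.indicator hset) fun p (hp : p.2 ≤ l) => ?_
        rcases le_or_gt p.2 0 with h0 | h0
        · simp [coneKernel_of_nonpos _ h0]
        by_cases hm : p ∈ Icc (α - l) (β + l) ×ˢ Iic l
        · rw [indicator_of_mem hm]
          calc _ ≤ ∫⁻ x, coneKernel x p * N p x := setLIntegral_le_lintegral _ _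
            _ = ∫⁻ x in Icc (p.1 - p.2) (p.1 + p.2), ENNReal.ofReal (1 / p.2) * N p x := by
              rw [← lintegral_indicator measurableSet_Icc]
              refine lintegral_congr fun x => ?_
              rw [coneKernel_eq_indicator, indicator_mul_left]
            _ ≤ ENNReal.ofReal (1 / p.2) * (c * ENNReal.ofReal p.2) := by
              rw [lintegral_const_mul' _ _ ENNReal.ofReal_ne_top]
              gcongr
              exact h p h0 hp
            _ = c := by
              rw [mul_left_comm, ← ENNReal.ofReal_mul (by positivity), one_div_mul_cancel h0.ne',
                ENNReal.ofReal_one, mul_one]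
        · rw [indicator_of_notMem hm, setLIntegral_congr_fun (g := fun _ => 0) measurableSet_Icc
            fun x hx => ?_]
          · simp
          · have : x ∉ Icc (p.1 - p.2) (p.1 + p.2) := fun hx' =>
              hm ⟨⟨by linarith [hx.1, hx'.2], by linarith [hx.2, hx'.1]⟩, hp⟩
            simp only [coneKernel_eq_indicator, indicator_of_notMem this, zero_mul]
    _ ≤ ∫⁻ p, (Icc (α - l) (β + l) ×ˢ Iic l).indicator (fun _ => c) p ∂σ :=
        setLIntegral_le_lintegral _ _
    _ = _ := lintegral_indicator_const hset c

theorem lintegral_truncatedArea_le (σ : Measure (ℝ × ℝ)) [SFinite σ] (α β l : ℝ) :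
    ∫⁻ x in Icc α β, truncatedArea σ l x ≤ 2 * σ (Icc (α - l) (β + l) ×ˢ Iic l) := by
  have := lintegral_truncatedArea_mul_le σ (c := 2) (α := α) (β := β) (l := l) (N := fun _ _ => 1)
    measurable_const fun p h0 _ => by
      rw [setLIntegral_const, Real.volume_Icc, one_mul, ← ENNReal.ofReal_ofNat 2,
        ← ENNReal.ofReal_mul zero_le_two]
      exact ENNReal.ofReal_le_ofReal (by linarith)
  simpa only [mul_one, truncatedArea] using this

/-- The square is a symmetric double integral over pairs `(p, q)`, hence at most twice its part
where `q` is not higher than `p`. -/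
theorem sq_truncatedArea_le (σ : Measure (ℝ × ℝ)) [SFinite σ] (l x : ℝ) :
    truncatedArea σ l x ^ 2 ≤
      2 * ∫⁻ p in {p : ℝ × ℝ | p.2 ≤ l}, coneKernel x p * truncatedArea σ p.2 x ∂σ := by
  set S := {p : ℝ × ℝ | p.2 ≤ l} with hS
  have hk : Measurable (coneKernel x) := measurable_coneKernel.comp measurable_prodMk_left
  set A : (ℝ × ℝ) → (ℝ × ℝ) → ℝ≥0∞ := fun p q =>
    {r : (ℝ × ℝ) × (ℝ × ℝ) | r.2.2 ≤ r.1.2}.indicator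
      (fun r => coneKernel x r.1 * coneKernel x r.2) (p, q) with hA
  have hAm : Measurable fun r : (ℝ × ℝ) × (ℝ × ℝ) => A r.1 r.2 :=
    ((hk.comp measurable_fst).mul (hk.comp measurable_snd)).indicator
      (measurableSet_le (by fun_prop) (by fun_prop))
  have hsplit : ∀ p q, coneKernel x p * coneKernel x q ≤ A p q + A q p := fun p q => by
    rcases le_total q.2 p.2 with h | h
    · have : A p q = coneKernel x p * coneKernel x q :=
        indicator_of_mem (show (p, q) ∈ {r : (ℝ × ℝ) × (ℝ × ℝ) | r.2.2 ≤ r.1.2} from h) _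
      rw [this]
      exact le_self_add
    · have : A q p = coneKernel x q * coneKernel x p :=
        indicator_of_mem (show (q, p) ∈ {r : (ℝ × ℝ) × (ℝ × ℝ) | r.2.2 ≤ r.1.2} from h) _
      rw [this, mul_comm]
      exact le_add_self
  have hinner : ∀ p, ∫⁻ q in S, A p q ∂σ ≤ coneKernel x p * truncatedArea σ p.2 x := fun p => by
    calc _ ≤ ∫⁻ q, A p q ∂σ := setLIntegral_le_lintegral _ _
      _ = ∫⁻ q in {q : ℝ × ℝ | q.2 ≤ p.2}, coneKernel x p * coneKernel x q ∂σ := by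
        rw [← lintegral_indicator (measurableSet_snd_le _)]
        rfl
      _ = _ := by rw [lintegral_const_mul _ hk, truncatedArea]
  calc truncatedArea σ l x ^ 2 = ∫⁻ p in S, ∫⁻ q in S, coneKernel x p * coneKernel x q ∂σ ∂σ := by
        simp_rw [lintegral_const_mul _ hk]
        rw [lintegral_mul_const _ hk, sq]
        rfl
    _ ≤ ∫⁻ p in S, ((∫⁻ q in S, A p q ∂σ) + ∫⁻ q in S, A q p ∂σ) ∂σ := by
        refine lintegral_mono fun p => ?_
        have hm : Measurable fun q => A p q := hAm.comp measurable_prodMk_left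
        rw [← lintegral_add_left hm]
        exact lintegral_mono fun q => hsplit p q
    _ = (∫⁻ p in S, ∫⁻ q in S, A p q ∂σ ∂σ) + ∫⁻ p in S, ∫⁻ q in S, A q p ∂σ ∂σ :=
        lintegral_add_left hAm.lintegral_prod_right' _
    _ = 2 * ∫⁻ p in S, ∫⁻ q in S, A p q ∂σ ∂σ := by
        rw [two_mul]
        congr 1
        exact lintegral_lintegral_swap (hAm.comp measurable_swap).aemeasurable
    _ ≤ _ := by
        gcongr with p
        exact hinner p

/-- The Carleson condition is used twice: for the inner first moment, on a box of width `4 * p.2`,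
and for the outer integral, on a box of width `3(β - α)`. Thus `48 = 2 * (2 * 4) * 3`. -/
theorem lintegral_sq_truncatedArea_le (σ : Measure (ℝ × ℝ)) [SFinite σ] {C : ℝ≥0∞}
    (hσ : ∀ u v : ℝ, u < v → σ (Icc u v ×ˢ Iic (v - u)) ≤ C * ENNReal.ofReal (v - u))
    {α β : ℝ} (hαβ : α < β) :
    ∫⁻ x in Icc α β, truncatedArea σ (β - α) x ^ 2 ≤ 48 * C ^ 2 * ENNReal.ofReal (β - α) := by
  have hl := sub_pos.2 hαβ
  have hbox : ∀ u v : ℝ, ∀ l > 0, l ≤ v - u → σ (Icc u v ×ˢ Iic l) ≤ C * ENNReal.ofReal (v - u) :=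
    fun u v l hl0 hle => (measure_mono (prod_mono le_rfl (Iic_subset_Iic.2 hle))).trans
      (hσ u v (by linarith))
  calc _ ≤ ∫⁻ x in Icc α β, 2 * ∫⁻ p in {p : ℝ × ℝ | p.2 ≤ β - α},
        coneKernel x p * truncatedArea σ p.2 x ∂σ :=
        lintegral_mono fun x => sq_truncatedArea_le σ _ x
    _ = 2 * ∫⁻ x in Icc α β, ∫⁻ p in {p : ℝ × ℝ | p.2 ≤ β - α},
        coneKernel x p * truncatedArea σ p.2 x ∂σ := lintegral_const_mul' _ _ ENNReal.ofNat_ne_top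
    _ ≤ 2 * (8 * C * σ (Icc (α - (β - α)) (β + (β - α)) ×ˢ Iic (β - α))) := by
        gcongr
        refine lintegral_truncatedArea_mul_le σ (N := fun p x => truncatedArea σ p.2 x)
          ((measurable_truncatedArea σ).comp
            (by fun_prop : Measurable fun q : ℝ × ℝ × ℝ => (q.2.2, q.1))) fun p h0 _ => ?_
        refine (lintegral_truncatedArea_le σ _ _ _).trans ?_
        calc _ ≤ 2 * (C * ENNReal.ofReal (p.1 + p.2 + p.2 - (p.1 - p.2 - p.2))) := by
              gcongr
              exact hbox _ _ _ h0 (by linarith)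
          _ = 2 * (C * ENNReal.ofReal (4 * p.2)) := by ring_nf
          _ = _ := by
              rw [ENNReal.ofReal_mul (by norm_num), ENNReal.ofReal_ofNat]
              ring
    _ ≤ 2 * (8 * C * (C * ENNReal.ofReal (β + (β - α) - (α - (β - α))))) := by
        gcongr
        exact hbox _ _ _ hl (by linarith)
    _ = 2 * (8 * C * (C * ENNReal.ofReal (3 * (β - α)))) := by ring_nf
    _ = _ := by
        rw [ENNReal.ofReal_mul (by norm_num), ENNReal.ofReal_ofNat]
        ring

/-! ### Carleson coefficients give derivatives in `BMO`. -/

/-- The measure `|a(y,h)| dy dh / h`. -/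
noncomputable def stripMeasure (a : ℝ × ℝ → ℝ) : Measure (ℝ × ℝ) :=
  volume.withDensity fun p => ‖a p‖ₑ * ENNReal.ofReal (1 / p.2)

instance (a : ℝ × ℝ → ℝ) : SFinite (stripMeasure a) := by
  unfold stripMeasure
  infer_instance

theorem lintegral_tentDeriv_kernel_le {a : ℝ × ℝ → ℝ} {M : ℝ} (ha : IsStripCoefficient a M)
    (l x : ℝ) : ∫⁻ p in {p : ℝ × ℝ | p.2 ≤ l}, ‖a p * (tentDeriv ((x - p.1) / p.2) / p.2 ^ 2)‖ₑ ≤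
      truncatedArea (stripMeasure a) l x := by
  have hk : Measurable (coneKernel x) := measurable_coneKernel.comp measurable_prodMk_left
  have hd : Measurable fun p : ℝ × ℝ => ‖a p‖ₑ * ENNReal.ofReal (1 / p.2) :=
    ha.measurable.enorm.mul (by fun_prop)
  rw [truncatedArea, stripMeasure, restrict_withDensity (measurableSet_snd_le l),
    lintegral_withDensity_eq_lintegral_mul _ hd hk]
  refine lintegral_mono fun p => ?_
  by_cases hp : p.2 ∈ Ioc (0 : ℝ) 2
  · have h0 := hp.1
    simp only [Pi.mul_apply]
    rw [enorm_mul, mul_assoc]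
    gcongr
    rw [coneKernel_eq_indicator, Real.enorm_eq_ofReal_abs, abs_div, abs_of_pos (pow_pos h0 2)]
    have hle := abs_tentDeriv_le_indicator ((x - p.1) / p.2)
    by_cases hx : x ∈ Icc (p.1 - p.2) (p.1 + p.2)
    · rw [indicator_of_mem hx, ← ENNReal.ofReal_mul (by positivity)]
      refine ENNReal.ofReal_le_ofReal ?_
      rw [div_mul_div_comm, one_mul, ← sq]
      gcongr
      exact hle.trans (indicator_le_self' (fun _ _ => zero_le_one) _)
    · rw [indicator_of_notMem hx, indicator_of_notMem (fun h => hx ?_)] at *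
      · rw [le_antisymm hle (abs_nonneg _)]
        simp
      · rw [mem_Icc, le_div_iff₀ h0, div_le_iff₀ h0] at h
        constructor <;> linarith [h.1, h.2]
  · rw [ha.eq_zero hp]
    simp

theorem lintegral_tentDeriv_kernel_le_truncatedArea_two {a : ℝ × ℝ → ℝ} {M : ℝ}
    (ha : IsStripCoefficient a M) (x : ℝ) :
    ∫⁻ p, ‖a p * (tentDeriv ((x - p.1) / p.2) / p.2 ^ 2)‖ₑ ≤
      truncatedArea (stripMeasure a) 2 x := by
  refine le_trans (le_of_eq ?_) (lintegral_tentDeriv_kernel_le ha 2 x)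
  rw [← lintegral_indicator (measurableSet_snd_le 2)]
  refine lintegral_congr fun p => ?_
  by_cases hp : p ∈ {p : ℝ × ℝ | p.2 ≤ 2}
  · rw [indicator_of_mem hp]
  · rw [indicator_of_notMem hp, ha.eq_zero fun h => hp h.2]
    simp

theorem lintegral_truncatedArea_two_lt_top {a : ℝ × ℝ → ℝ} {C : ℝ≥0}
    (hC : ∀ u v : ℝ, u < v → stripMeasure a (Icc u v ×ˢ Iic (v - u)) ≤ C * ENNReal.ofReal (v - u))
    {α β : ℝ} (hαβ : α ≤ β) : ∫⁻ x in Icc α β, truncatedArea (stripMeasure a) 2 x < ∞ := by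
  refine (lintegral_truncatedArea_le _ α β 2).trans_lt ?_
  refine ENNReal.mul_lt_top ENNReal.ofNat_lt_top ?_
  -- The box over `[α-2, β+2]` has width at least `4`, so its Carleson box contains the whole height
  -- `2`.
  refine (measure_mono (prod_mono le_rfl (Iic_subset_Iic.2 (by linarith)))).trans_lt
    ((hC (α - 2) (β + 2) (by linarith)).trans_lt
      (ENNReal.mul_lt_top ENNReal.coe_lt_top ENNReal.ofReal_lt_top))

theorem measurable_tentPotentialDeriv {a : ℝ × ℝ → ℝ} (ha : Measurable a) :
    Measurable (tentPotentialDeriv a) :=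
  (StronglyMeasurable.integral_prod_right'
    (measurable_tentDeriv_kernel ha).stronglyMeasurable).measurable

theorem locallyIntegrable_tentPotentialDeriv {a : ℝ × ℝ → ℝ} {M : ℝ} (ha : IsStripCoefficient a M)
    {C : ℝ≥0} (hC : ∀ u v : ℝ, u < v →
      stripMeasure a (Icc u v ×ˢ Iic (v - u)) ≤ C * ENNReal.ofReal (v - u)) :
    LocallyIntegrable (tentPotentialDeriv a) volume := by
  intro x
  refine ⟨Icc (x - 1) (x + 1), Icc_mem_nhds (by linarith) (by linarith),
    (measurable_tentPotentialDeriv ha.measurable).aestronglyMeasurable, ?_⟩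
  refine lt_of_le_of_lt (lintegral_mono fun t => ?_)
    (lintegral_truncatedArea_two_lt_top hC (show x - 1 ≤ x + 1 by linarith))
  exact (enorm_integral_le_lintegral_enorm _).trans
    (lintegral_tentDeriv_kernel_le_truncatedArea_two ha t)

theorem IsStripCoefficient.indicator {a : ℝ × ℝ → ℝ} {M : ℝ} (ha : IsStripCoefficient a M)
    {S : Set (ℝ × ℝ)} (hS : MeasurableSet S) : IsStripCoefficient (S.indicator a) M where
  measurable := ha.measurable.indicator hS
  abs_le p := by
    by_cases h : p ∈ S
    · rw [indicator_of_mem h]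
      exact ha.abs_le p
    · rw [indicator_of_notMem h, abs_zero]
      exact ha.nonneg
  mem_strip p hp := ha.mem_strip p fun h => hp (indicator_apply_eq_zero.2 fun _ => h)

theorem IsStripCoefficient.integrable_tentDeriv_kernel_of_lt {a : ℝ × ℝ → ℝ} {M : ℝ}
    (ha : IsStripCoefficient a M) {l : ℝ} (hl : 0 < l) (hal : ∀ p, a p ≠ 0 → l < p.2) (x : ℝ) :
    Integrable fun p : ℝ × ℝ => a p * (tentDeriv ((x - p.1) / p.2) / p.2 ^ 2) := by
  have hm : Measurable fun p : ℝ × ℝ => a p * (tentDeriv ((x - p.1) / p.2) / p.2 ^ 2) :=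
    (measurable_tentDeriv_kernel ha.measurable).comp measurable_prodMk_left
  refine ⟨hm.aestronglyMeasurable, ?_⟩
  refine (lintegral_prod_le_of_slices hm.enorm
    (K := (Ioc 0 2).indicator fun _ => ENNReal.ofReal M * ENNReal.ofReal (2 / l)) fun t => ?_).trans_lt
      ?_
  · by_cases ht : t ∈ Ioc (0 : ℝ) 2 ∧ l < t
    · rw [indicator_of_mem ht.1]
      have h0 := ht.1.1
      have hG : Measurable fun u => tentDeriv u / t := by fun_prop
      have e : ∀ u, tentDeriv u / t ^ 2 = tentDeriv u / t / t := fun u => by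
        rw [div_div, ← sq]
      simp_rw [e]
      refine (ha.lintegral_slice_le hG x h0).trans ?_
      gcongr
      calc _ ≤ ∫⁻ u : ℝ, ENNReal.ofReal (1 / l) *
            ENNReal.ofReal ((Icc (-1) 1).indicator (fun _ => (1 : ℝ)) u) := by
            refine lintegral_mono fun u => ?_
            rw [← ENNReal.ofReal_mul (by positivity), abs_div, abs_of_pos h0, one_div_mul_eq_div]
            refine ENNReal.ofReal_le_ofReal ?_
            exact div_le_div₀ (indicator_nonneg (fun _ _ => zero_le_one) u)
              (abs_tentDeriv_le_indicator u) hl ht.2.le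
        _ = _ := by
            rw [lintegral_const_mul' _ _ ENNReal.ofReal_ne_top,
              lintegral_ofReal_indicator_one measurableSet_Icc, Real.volume_Icc,
              ← ENNReal.ofReal_mul (by positivity)]
            congr 1
            ring
    · have hz : ∀ y, a (y, t) = 0 := fun y => by
        by_contra h
        exact ht ⟨ha.mem_strip _ h, hal _ h⟩
      simp [hz]
  · rw [lintegral_indicator measurableSet_Ioc, setLIntegral_const, Real.volume_Ioc]
    exact ENNReal.mul_lt_top (ENNReal.mul_lt_top ENNReal.ofReal_lt_top ENNReal.ofReal_lt_top)
      ENNReal.ofReal_lt_top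

/-- Only boundedness of `a` matters above height `l`: the slice at height `t` contributes at most
`6M|z-x|/t²`, which is integrated over `t > l`. -/
theorem IsStripCoefficient.abs_tentPotentialDeriv_sub_le {a : ℝ × ℝ → ℝ} {M : ℝ}
    (ha : IsStripCoefficient a M) {l : ℝ} (hl : 0 < l) (hal : ∀ p, a p ≠ 0 → l < p.2) (x z : ℝ) :
    |tentPotentialDeriv a x - tentPotentialDeriv a z| ≤ M * (6 * |z - x| / l) := by
  have hi := ha.integrable_tentDeriv_kernel_of_lt hl hal
  rw [tentPotentialDeriv, tentPotentialDeriv, ← integral_sub (hi x) (hi z)]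
  have hm : Measurable fun p : ℝ × ℝ => a p * (tentDeriv ((x - p.1) / p.2) / p.2 ^ 2) -
      a p * (tentDeriv ((z - p.1) / p.2) / p.2 ^ 2) :=
    ((measurable_tentDeriv_kernel ha.measurable).comp measurable_prodMk_left).sub
      ((measurable_tentDeriv_kernel ha.measurable).comp measurable_prodMk_left)
  have hle := (enorm_integral_le_lintegral_enorm (μ := volume) fun p : ℝ × ℝ =>
    a p * (tentDeriv ((x - p.1) / p.2) / p.2 ^ 2) -
      a p * (tentDeriv ((z - p.1) / p.2) / p.2 ^ 2)).trans
    (lintegral_prod_le_of_slices hm.enorm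
      (K := (Ioi l).indicator fun t => ENNReal.ofReal M *
        ENNReal.ofReal (6 * |z - x| / t ^ 2)) fun t => ?_)
  · rw [lintegral_indicator measurableSet_Ioi, lintegral_const_mul' _ _ ENNReal.ofReal_ne_top,
      lintegral_Ioi_ofReal_div_sq (by positivity) hl, ← ENNReal.ofReal_mul ha.nonneg,
      Real.enorm_eq_ofReal_abs, ENNReal.ofReal_le_ofReal_iff
        (mul_nonneg ha.nonneg (by positivity))] at hle
    exact hle
  · by_cases ht : l < t
    · rw [indicator_of_mem (show t ∈ Ioi l from ht)]
      have h0 := hl.trans ht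
      have hG : Measurable fun u => (tentDeriv u - tentDeriv (u + (z - x) / t)) / t := by fun_prop
      have e : ∀ y, a (y, t) * (tentDeriv ((x - y) / t) / t ^ 2) -
          a (y, t) * (tentDeriv ((z - y) / t) / t ^ 2) =
          a (y, t) * ((tentDeriv ((x - y) / t) - tentDeriv ((x - y) / t + (z - x) / t)) / t / t) := by
        intro y
        have : (z - y) / t = (x - y) / t + (z - x) / t := by ring
        rw [this, div_div, ← sq]
        ring
      simp_rw [e]
      refine (ha.lintegral_slice_le hG x h0).trans ?_
      gcongr
      calc _ = ∫⁻ u, ENNReal.ofReal (1 / t) *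
            ENNReal.ofReal |tentDeriv u - tentDeriv (u + (z - x) / t)| := by
            refine lintegral_congr fun u => ?_
            rw [← ENNReal.ofReal_mul (by positivity), abs_div, abs_of_pos h0, one_div_mul_eq_div]
        _ ≤ ENNReal.ofReal (1 / t) * ENNReal.ofReal (6 * |(z - x) / t|) := by
            rw [lintegral_const_mul' _ _ ENNReal.ofReal_ne_top]
            gcongr
            exact lintegral_abs_tentDeriv_sub_le _
        _ = _ := by
            rw [← ENNReal.ofReal_mul (by positivity), abs_div, abs_of_pos h0]
            congr 1
            field_simp
    · have hz : ∀ y, a (y, t) = 0 := fun y => by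
        by_contra h
        exact ht (hal _ h)
      simp [hz]

/-- The mean minimises the mean square deviation, so any convenient constant may replace it in `BMO`
estimates. -/
theorem lintegral_sub_average_sq_le {φ : ℝ → ℝ} (hφ : LocallyIntegrable φ volume) {α β : ℝ}
    (hαβ : α < β) (c : ℝ) :
    ∫⁻ x in Icc α β, ENNReal.ofReal (|φ x - ⨍ y in Icc α β, φ y| ^ 2) ≤
      ∫⁻ x in Icc α β, ENNReal.ofReal (|φ x - c| ^ 2) := by
  rcases eq_or_ne (∫⁻ x in Icc α β, ENNReal.ofReal (|φ x - c| ^ 2)) ∞ with htop | hfin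
  · rw [htop]
    exact le_top
  have hb := sub_pos.2 hαβ
  have h1 : IntegrableOn φ (Icc α β) := hφ.integrableOn_isCompact isCompact_Icc
  have hmeas := h1.aestronglyMeasurable.sub (aestronglyMeasurable_const (b := c))
  have h2c : IntegrableOn (fun x => (φ x - c) ^ 2) (Icc α β) := by
    refine ⟨hmeas.pow 2, ?_⟩
    rw [hasFiniteIntegral_iff_ofReal (ae_of_all _ fun x => sq_nonneg _)]
    simp_rw [sq_abs] at hfin
    exact hfin.lt_top
  -- Changing the constant alters the square by an affine function of `φ`, which is integrable.
  have hi : ∀ d : ℝ, IntegrableOn (fun x => (φ x - d) ^ 2) (Icc α β) := fun d => by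
    have hL : IntegrableOn (fun x => 2 * (c - d) * (φ x - c)) (Icc α β) :=
      (h1.sub (integrable_const c)).const_mul _
    have : (fun x => (φ x - d) ^ 2) =
        fun x => (φ x - c) ^ 2 + 2 * (c - d) * (φ x - c) + (c - d) ^ 2 := by
      ext x
      ring
    rw [this]
    exact (h2c.add hL).add (integrable_const _)
  have h2 : IntegrableOn (fun x => φ x ^ 2) (Icc α β) := by simpa using hi 0
  simp_rw [sq_abs]
  rw [← ofReal_integral_eq_lintegral_ofReal (hi _) (ae_of_all _ fun x => sq_nonneg _),
    ← ofReal_integral_eq_lintegral_ofReal (hi _) (ae_of_all _ fun x => sq_nonneg _)]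
  refine ENNReal.ofReal_le_ofReal ?_
  rw [integral_sq_sub_average hαβ h1 h2]
  have e : ∫ x in Icc α β, (φ x - c) ^ 2 =
      (∫ x in α..β, φ x ^ 2) - 2 * c * (∫ x in α..β, φ x) + c ^ 2 * (β - α) := by
    have key : ∀ x, (φ x - c) ^ 2 = φ x ^ 2 - 2 * c * φ x + c ^ 2 := fun x => by ring
    simp_rw [key]
    have i1 : IntegrableOn (fun x => 2 * c * φ x) (Icc α β) := h1.const_mul _
    have i2 : IntegrableOn (fun x => φ x ^ 2 - 2 * c * φ x) (Icc α β) := h2.sub i1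
    rw [integral_add i2 (integrable_const _), integral_sub h2 i1, integral_const_mul,
      integral_const, measureReal_restrict_apply_univ, Measure.real, Real.volume_Icc,
      ENNReal.toReal_ofReal hb.le, intervalIntegral.integral_of_le hαβ.le,
      intervalIntegral.integral_of_le hαβ.le, integral_Icc_eq_integral_Ioc,
      integral_Icc_eq_integral_Ioc, smul_eq_mul]
    ring
  rw [e]
  set A := ∫ x in α..β, φ x
  have h3 : 0 ≤ (A - c * (β - α)) ^ 2 / (β - α) := by positivity
  have h4 : (A - c * (β - α)) ^ 2 / (β - α) = A ^ 2 / (β - α) - 2 * c * A + c ^ 2 * (β - α) := by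
    field_simp
    ring
  linarith

theorem bmoNorm_lt_top_of_forall_exists {φ : ℝ → ℝ} (hφ : LocallyIntegrable φ volume) {K : ℝ≥0}
    (h : ∀ α β : ℝ, α < β → ∃ c : ℝ, ∫⁻ x in Icc α β, ENNReal.ofReal (|φ x - c| ^ 2) ≤
      K * ENNReal.ofReal (β - α)) : bmoNorm φ < ∞ := by
  refine lt_of_le_of_lt (b := (K : ℝ≥0∞) ^ (1 / 2 : ℝ)) ?_
    (ENNReal.rpow_lt_top_of_nonneg (by norm_num) ENNReal.coe_ne_top)
  refine iSup_le fun α => iSup_le fun β => iSup_le fun hαβ => ?_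
  obtain ⟨c, hc⟩ := h α β hαβ
  refine ENNReal.rpow_le_rpow ?_ (by norm_num)
  rw [ENNReal.inv_mul_le_iff (by simpa using hαβ) ENNReal.ofReal_ne_top, mul_comm]
  exact (lintegral_sub_average_sq_le hφ hαβ c).trans hc

/-- The comparison constant is the value at `α` of the part above height `β - α`. That part varies
by at most `6M` on the interval, and the part below is dominated by the area function. -/
theorem IsStripCoefficient.ofReal_sq_abs_tentPotentialDeriv_sub_le {a : ℝ × ℝ → ℝ} {M : ℝ}
    (ha : IsStripCoefficient a M) {α β x : ℝ} (hαβ : α < β) (hx : x ∈ Icc α β) :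
    ENNReal.ofReal (|tentPotentialDeriv a x -
        tentPotentialDeriv ({p : ℝ × ℝ | p.2 ≤ β - α}ᶜ.indicator a) α| ^ 2) ≤
      2 * truncatedArea (stripMeasure a) (β - α) x ^ 2 + 2 * ENNReal.ofReal (6 * M) ^ 2 := by
  have hl := sub_pos.2 hαβ
  set S : Set (ℝ × ℝ) := {p : ℝ × ℝ | p.2 ≤ β - α} with hS
  have hSm : MeasurableSet S := measurableSet_snd_le _
  set N := truncatedArea (stripMeasure a) (β - α) x with hN
  -- Finiteness of `N` is what makes the low part absolutely convergent at `x`; otherwise the bound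
  -- is trivial.
  rcases eq_or_ne N ∞ with htop | hfin
  · rw [htop]
    simp
  have ha₂ := ha.indicator hSm.compl
  have hal : ∀ p, Sᶜ.indicator a p ≠ 0 → β - α < p.2 := fun p hp => by
    by_contra h
    exact hp (indicator_of_notMem (s := Sᶜ) (notMem_compl_iff.2 (not_lt.1 h)) a)
  have hK := lintegral_tentDeriv_kernel_le ha (β - α) x
  have hm : Measurable fun p : ℝ × ℝ => a p * (tentDeriv ((x - p.1) / p.2) / p.2 ^ 2) :=
    (measurable_tentDeriv_kernel ha.measurable).comp measurable_prodMk_left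
  have i₁ : IntegrableOn (fun p : ℝ × ℝ => a p * (tentDeriv ((x - p.1) / p.2) / p.2 ^ 2)) S :=
    ⟨hm.aestronglyMeasurable, hK.trans_lt hfin.lt_top⟩
  have e₂ : (fun p : ℝ × ℝ => Sᶜ.indicator a p * (tentDeriv ((x - p.1) / p.2) / p.2 ^ 2)) =
      Sᶜ.indicator fun p : ℝ × ℝ => a p * (tentDeriv ((x - p.1) / p.2) / p.2 ^ 2) := by
    ext p
    rw [indicator_mul_left]
  have i₂ : IntegrableOn (fun p : ℝ × ℝ => a p * (tentDeriv ((x - p.1) / p.2) / p.2 ^ 2)) Sᶜ := by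
    rw [← integrable_indicator_iff hSm.compl, ← e₂]
    exact ha₂.integrable_tentDeriv_kernel_of_lt hl hal x
  have hsum : tentPotentialDeriv a x =
      (∫ p in S, a p * (tentDeriv ((x - p.1) / p.2) / p.2 ^ 2)) +
        tentPotentialDeriv (Sᶜ.indicator a) x := by
    have hi : Integrable fun p : ℝ × ℝ => a p * (tentDeriv ((x - p.1) / p.2) / p.2 ^ 2) := by
      rw [← integrableOn_univ, ← union_compl_self S]
      exact i₁.union i₂
    rw [tentPotentialDeriv, tentPotentialDeriv, e₂, integral_indicator hSm.compl,
      integral_add_compl hSm hi]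
  have hb₁ : |∫ p in S, a p * (tentDeriv ((x - p.1) / p.2) / p.2 ^ 2)| ≤ N.toReal := by
    have := (enorm_integral_le_lintegral_enorm _).trans hK
    rwa [← hN, ← ENNReal.ofReal_toReal hfin, Real.enorm_eq_ofReal_abs,
      ENNReal.ofReal_le_ofReal_iff ENNReal.toReal_nonneg] at this
  have hb₂ := ha₂.abs_tentPotentialDeriv_sub_le hl hal x α
  have hb₃ : M * (6 * |α - x| / (β - α)) ≤ 6 * M := by
    have h1 : |α - x| ≤ β - α := by
      rw [abs_sub_comm, abs_of_nonneg (by linarith [hx.1])]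
      linarith [hx.2]
    have h2 : |α - x| / (β - α) ≤ 1 := (div_le_one hl).2 h1
    calc _ = 6 * M * (|α - x| / (β - α)) := by ring
      _ ≤ 6 * M * 1 := mul_le_mul_of_nonneg_left h2 (mul_nonneg (by norm_num) ha.nonneg)
      _ = _ := mul_one _
  have hb : |tentPotentialDeriv a x - tentPotentialDeriv (Sᶜ.indicator a) α| ≤
      N.toReal + 6 * M := by
    rw [hsum, add_sub_assoc]
    exact (abs_add_le _ _).trans (add_le_add hb₁ (hb₂.trans hb₃))
  have hM := ha.nonneg
  have hN0 : 0 ≤ N.toReal := ENNReal.toReal_nonneg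
  calc _ ≤ ENNReal.ofReal (2 * N.toReal ^ 2 + 2 * (6 * M) ^ 2) := by
        refine ENNReal.ofReal_le_ofReal ?_
        calc _ ≤ (N.toReal + 6 * M) ^ 2 := by gcongr
          _ ≤ _ := by linarith [sq_nonneg (N.toReal - 6 * M)]
    _ = _ := by
        rw [ENNReal.ofReal_add (by positivity) (by positivity), ENNReal.ofReal_mul zero_le_two,
          ENNReal.ofReal_mul zero_le_two, ENNReal.ofReal_pow hN0, ENNReal.ofReal_pow (by positivity),
          ENNReal.ofReal_toReal hfin, ENNReal.ofReal_ofNat]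

theorem IsStripCoefficient.tentPotentialDeriv_mem_BMO {a : ℝ × ℝ → ℝ} {M : ℝ}
    (ha : IsStripCoefficient a M) {C : ℝ≥0} (hC : ∀ u v : ℝ, u < v →
      stripMeasure a (Icc u v ×ˢ Iic (v - u)) ≤ C * ENNReal.ofReal (v - u)) :
    tentPotentialDeriv a ∈ BMO := by
  have hloc := locallyIntegrable_tentPotentialDeriv ha hC
  refine ⟨hloc, bmoNorm_lt_top_of_forall_exists hloc
    (K := 2 * (48 * C ^ 2) + 2 * (6 * M).toNNReal ^ 2) fun α β hαβ =>
      ⟨tentPotentialDeriv ({p : ℝ × ℝ | p.2 ≤ β - α}ᶜ.indicator a) α, ?_⟩⟩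
  calc _ ≤ ∫⁻ x in Icc α β, (2 * truncatedArea (stripMeasure a) (β - α) x ^ 2 +
        2 * ENNReal.ofReal (6 * M) ^ 2) :=
        setLIntegral_mono' measurableSet_Icc fun x hx =>
          ha.ofReal_sq_abs_tentPotentialDeriv_sub_le hαβ hx
    _ ≤ 2 * (48 * C ^ 2 * ENNReal.ofReal (β - α)) +
        2 * ENNReal.ofReal (6 * M) ^ 2 * ENNReal.ofReal (β - α) := by
        rw [lintegral_add_right _ measurable_const, setLIntegral_const, Real.volume_Icc,
          lintegral_const_mul' _ _ ENNReal.ofNat_ne_top]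
        gcongr
        exact lintegral_sq_truncatedArea_le _ hC hαβ
    _ = _ := by
        push_cast
        simp only [ENNReal.ofReal]
        ring

/-! ### Carleson tent potentials belong to `I(BMO)`. -/

theorem integral_tentDeriv (u v : ℝ) :
    ∫ t in u..v, tentDeriv t = tent v - tent u := by
  refine intervalIntegral.integral_eq_sub_of_hasDeriv_right continuous_tent.continuousOn
    (fun x _ => hasDerivWithinAt_tent x) ?_
  refine IntervalIntegrable.mono_fun (intervalIntegrable_const (c := (1 : ℝ)))
    measurable_tentDeriv.aestronglyMeasurable (ae_of_all _ fun x => ?_)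
  rw [norm_one]
  exact (abs_tentDeriv_le_indicator x).trans (indicator_le_self' (fun _ _ => zero_le_one) x)

theorem integral_tentDeriv_kernel {h : ℝ} (hh : 0 < h) (y α β : ℝ) :
    ∫ t in α..β, tentDeriv ((t - y) / h) / h ^ 2 =
      tent ((β - y) / h) / h - tent ((α - y) / h) / h := by
  rw [intervalIntegral.integral_div,
    intervalIntegral.integral_comp_sub_right (fun t => tentDeriv (t / h)),
    intervalIntegral.integral_comp_div _ hh.ne', integral_tentDeriv, smul_eq_mul]
  field_simp

/-- Fubini reduces this to a single tent; absolute integrability comes from the first moment of the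
area function at height `2`. -/
theorem IsStripCoefficient.integral_tentPotentialDeriv {a : ℝ × ℝ → ℝ} {M : ℝ}
    (ha : IsStripCoefficient a M) {C : ℝ≥0} (hC : ∀ u v : ℝ, u < v →
      stripMeasure a (Icc u v ×ˢ Iic (v - u)) ≤ C * ENNReal.ofReal (v - u)) {α β : ℝ}
    (hαβ : α ≤ β) :
    ∫ t in α..β, tentPotentialDeriv a t = tentPotential a β - tentPotential a α := by
  have hm := measurable_tentDeriv_kernel ha.measurable
  have hint : Integrable (Function.uncurry fun (t : ℝ) (p : ℝ × ℝ) =>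
      a p * (tentDeriv ((t - p.1) / p.2) / p.2 ^ 2))
      ((volume.restrict (Ioc α β)).prod volume) := by
    refine ⟨hm.aestronglyMeasurable, ?_⟩
    refine lt_of_le_of_lt (lintegral_prod _ hm.enorm.aemeasurable).le
      (lt_of_le_of_lt ?_ (lintegral_truncatedArea_two_lt_top hC hαβ))
    rw [restrict_Ioc_eq_restrict_Icc]
    exact lintegral_mono fun t => lintegral_tentDeriv_kernel_le_truncatedArea_two ha t
  rw [intervalIntegral.integral_of_le hαβ]
  simp only [tentPotentialDeriv]
  rw [integral_integral_swap hint, tentPotential, tentPotential,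
    ← integral_sub (ha.integrable_tent_kernel β) (ha.integrable_tent_kernel α)]
  refine integral_congr_ae (ae_of_all _ fun p => ?_)
  dsimp only
  rw [integral_const_mul, ← mul_sub]
  by_cases hp : p.2 ∈ Ioc (0 : ℝ) 2
  · rw [← intervalIntegral.integral_of_le hαβ, integral_tentDeriv_kernel hp.1]
  · rw [ha.eq_zero hp, zero_mul, zero_mul]

theorem IsStripCoefficient.tentPotential_mem_IBMO {a : ℝ × ℝ → ℝ} {M : ℝ}
    (ha : IsStripCoefficient a M) {C : ℝ≥0} (hC : ∀ u v : ℝ, u < v →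
      stripMeasure a (Icc u v ×ˢ Iic (v - u)) ≤ C * ENNReal.ofReal (v - u)) :
    tentPotential a ∈ IBMO := by
  have hloc := locallyIntegrable_tentPotentialDeriv ha hC
  have hprim : ∀ x, tentPotential a x =
      tentPotential a 0 + ∫ t in (0 : ℝ)..x, tentPotentialDeriv a t := fun x => by
    rcases le_total 0 x with h | h
    · rw [ha.integral_tentPotentialDeriv hC h]
      ring
    · rw [intervalIntegral.integral_symm, ha.integral_tentPotentialDeriv hC h]
      ring
  refine ⟨?_, tentPotentialDeriv a, ha.tentPotentialDeriv_mem_BMO hC,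
    isDistributionalDeriv_of_primitive hloc hprim⟩
  rw [funext hprim]
  exact continuous_const.add
    (intervalIntegral.continuous_primitive (locallyIntegrable_intervalIntegrable hloc) 0)

/-! ### The reproducing formula. -/

theorem support_tent_subset {u : ℝ} (h : tent u ≠ 0) : u ∈ Ioo (-1 : ℝ) 1 := by
  by_contra hn
  rw [mem_Ioo, not_and_or, not_lt, not_lt] at hn
  rcases hn with hn | hn
  · exact h (tent_of_le_neg_one hn)
  · exact h (tent_of_one_le hn)

theorem hasCompactSupport_tent : HasCompactSupport tent :=
  HasCompactSupport.intro (isCompact_Icc (a := -1) (b := 1)) fun u hu => by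
    by_contra h
    exact hu (Ioo_subset_Icc_self (support_tent_subset h))

theorem integrable_mul_tent {g : ℝ → ℝ} (hg : Continuous g) :
    Integrable fun u => g u * tent u :=
  (hg.mul continuous_tent).integrable_of_hasCompactSupport hasCompactSupport_tent.mul_left

theorem integral_mul_tent_eq_intervalIntegral (g : ℝ → ℝ) :
    ∫ u, g u * tent u = ∫ u in (-1 : ℝ)..1, g u * tent u :=
  integral_eq_intervalIntegral_of_support one_pos fun _ hu =>
    support_tent_subset (right_ne_zero_of_mul hu)

theorem integral_tent : ∫ u, tent u = 1 := by
  have h := integral_mul_tent_eq_intervalIntegral fun _ => 1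
  simp only [one_mul] at h
  rw [h, ← intervalIntegral.integral_add_adjacent_intervals
    (continuous_tent.intervalIntegrable (-1) 0) (continuous_tent.intervalIntegrable 0 1)]
  have e1 : ∫ u in (-1 : ℝ)..0, tent u = ∫ u in (-1 : ℝ)..0, (1 + u) := by
    refine intervalIntegral.integral_congr fun u hu => ?_
    rw [uIcc_of_le (by norm_num)] at hu
    exact tent_of_mem_left hu.1 hu.2
  have e2 : ∫ u in (0 : ℝ)..1, tent u = ∫ u in (0 : ℝ)..1, (1 - u) := by
    refine intervalIntegral.integral_congr fun u hu => ?_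
    rw [uIcc_of_le (by norm_num)] at hu
    exact tent_of_mem_right hu.1 hu.2
  rw [e1, e2, intervalIntegral.integral_add (by simp) (by simp),
    intervalIntegral.integral_sub (by simp) (by simp)]
  norm_num [integral_id]

/-- The two-scale relation that converts second differences at step `h` into differences of tent
averages at the scales `2h` and `h`. -/
theorem tent_half (v : ℝ) : tent (v / 2) = tent (v + 1) / 2 + tent v + tent (v - 1) / 2 := by
  unfold tent
  grind

/-- The refinement equation of the tent function, tested against `g`. -/
theorem integral_second_difference_mul_tent {g : ℝ → ℝ} (hg : Continuous g) :
    ∫ u, (g (u - 1) - 2 * g u + g (u + 1)) * tent u =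
      4 * ((∫ u, g (2 * u) * tent u) - ∫ u, g u * tent u) := by
  have i1 : Integrable fun u => g (u - 1) * tent u :=
    integrable_mul_tent (hg.comp (continuous_sub_right 1))
  have i2 := integrable_mul_tent hg
  have i3 : Integrable fun u => g (u + 1) * tent u :=
    integrable_mul_tent (hg.comp (continuous_add_const 1))
  have j1 : Integrable fun u => g u * tent (u + 1) := by simpa using i1.comp_add_right 1
  have j3 : Integrable fun u => g u * tent (u - 1) := by simpa using i3.comp_sub_right 1
  have s1 : ∫ u, g (u - 1) * tent u = ∫ u, g u * tent (u + 1) := by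
    rw [← integral_add_right_eq_self _ (1 : ℝ)]
    simp
  have s3 : ∫ u, g (u + 1) * tent u = ∫ u, g u * tent (u - 1) := by
    rw [← integral_sub_right_eq_self _ (1 : ℝ)]
    simp
  have hL : ∫ u, (g (u - 1) - 2 * g u + g (u + 1)) * tent u =
      (∫ u, g (u - 1) * tent u) - 2 * (∫ u, g u * tent u) + ∫ u, g (u + 1) * tent u := by
    rw [← integral_const_mul, ← integral_sub i1 (i2.const_mul 2)]
    refine Eq.trans ?_ (integral_add (i1.sub (i2.const_mul 2)) i3)
    refine integral_congr_ae (ae_of_all _ fun u => ?_)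
    dsimp only
    ring
  have hR : ∫ u, g (2 * u) * tent u =
      (1 / 4) * (∫ u, g u * tent (u + 1)) + (1 / 2) * (∫ u, g u * tent u) +
        (1 / 4) * ∫ u, g u * tent (u - 1) := by
    have h := Measure.integral_comp_mul_left (fun v => g v * tent (v / 2)) 2
    simp only [smul_eq_mul] at h
    have e : ∫ u, g (2 * u) * tent (2 * u / 2) = ∫ u, g (2 * u) * tent u := by
      refine integral_congr_ae (ae_of_all _ fun u => ?_)
      simp
    rw [← e, h, ← integral_const_mul, ← integral_const_mul, ← integral_const_mul,
      ← integral_const_mul, ← integral_add (j1.const_mul _) (i2.const_mul _)]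
    refine Eq.trans ?_ (integral_add ((j1.const_mul _).add (i2.const_mul _)) (j3.const_mul _))
    refine integral_congr_ae (ae_of_all _ fun u => ?_)
    simp only [tent_half]
    rw [abs_of_pos (by norm_num)]
    ring
  rw [hL, hR, s1, s3]
  ring

theorem integral_mul_tent_comp (G : ℝ → ℝ) (x : ℝ) {h : ℝ} (hh : 0 < h) :
    ∫ y, G y * (tent ((x - y) / h) / h) = ∫ u, G (x - h * u) * tent u := by
  rw [← integral_sub_left_eq_self (fun y => G y * (tent ((x - y) / h) / h)) volume x]
  have h1 := Measure.integral_comp_mul_left (fun y => G (x - y) * (tent (y / h) / h)) h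
  simp only [smul_eq_mul] at h1
  simp only [sub_sub_cancel]
  have h2 : ∫ u, G (x - h * u) * tent u =
      h * ∫ u, G (x - h * u) * (tent (h * u / h) / h) := by
    rw [← integral_const_mul]
    refine integral_congr_ae (ae_of_all _ fun u => ?_)
    simp only [mul_div_cancel_left₀ u hh.ne']
    field_simp
  rw [h2, h1, abs_of_pos (inv_pos.2 hh), ← mul_assoc, mul_inv_cancel₀ hh.ne', one_mul]

/-- The average of `f` around `x` against the tent of width `h`. -/
noncomputable def tentAverage (f : ℝ → ℝ) (x h : ℝ) : ℝ := ∫ u, f (x - h * u) * tent u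

theorem continuous_tentAverage {f : ℝ → ℝ} (hf : Continuous f) (x : ℝ) :
    Continuous (tentAverage f x) := by
  have : tentAverage f x = fun h => ∫ u in (-1 : ℝ)..1, f (x - h * u) * tent u :=
    funext fun h => integral_mul_tent_eq_intervalIntegral fun u => f (x - h * u)
  rw [this]
  exact intervalIntegral.continuous_parametric_intervalIntegral_of_continuous'
    (f := fun h u => f (x - h * u) * tent u) (by fun_prop) (-1) 1

theorem tentAverage_zero (f : ℝ → ℝ) (x : ℝ) : tentAverage f x 0 = f x := by
  simp [tentAverage, integral_const_mul, integral_tent]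

theorem integral_secondDividedDifference_mul_tent {f : ℝ → ℝ} (hf : Continuous f) (x : ℝ) {h : ℝ}
    (hh : 0 < h) :
    ∫ y, secondDividedDifference f y h * (tent ((x - y) / h) / h) =
      4 * ((tentAverage f x (2 * h) - tentAverage f x h) / h) := by
  rw [integral_mul_tent_comp (fun y => secondDividedDifference f y h) x hh]
  have h1 := integral_second_difference_mul_tent (g := fun u => f (x - h * u)) (by fun_prop)
  have e : ∀ u, x - h * (2 * u) = x - 2 * h * u := fun u => by ring
  simp only [e] at h1
  rw [tentAverage, tentAverage, ← mul_div_assoc, ← h1, ← integral_div]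
  refine integral_congr_ae (ae_of_all _ fun u => ?_)
  have e1 : x - h * (u - 1) = x - h * u + h := by ring
  have e2 : x - h * (u + 1) = x - h * u - h := by ring
  simp only [secondDividedDifference, e1, e2]
  ring

/-- A Frullani integral: the integrand is the derivative in `δ` of the integral of `F h / h` over
`[δ, 2δ]`. -/
theorem integral_two_mul_sub_div {F : ℝ → ℝ} (hF : Continuous F)
    (hi : IntervalIntegrable (fun h => (F (2 * h) - F h) / h) volume 0 1) :
    ∫ h in (0 : ℝ)..1, (F (2 * h) - F h) / h =
      (∫ h in (1 : ℝ)..2, F h / h) - F 0 * Real.log 2 := by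
  -- Rescaling `[δ, 2δ]` to `[1, 2]` extends the integral continuously to `δ = 0`, with value `F 0 *
  -- log 2`. The maximum equals `u` on `[1, 2]` and only makes the integrand continuous everywhere.
  set Φ : ℝ → ℝ := fun δ => ∫ u in (1 : ℝ)..2, F (δ * u) / max u 1 with hΦ
  have hΦc : Continuous Φ :=
    intervalIntegral.continuous_parametric_intervalIntegral_of_continuous'
      (f := fun δ u => F (δ * u) / max u 1)
      ((hF.comp (by fun_prop)).div (by fun_prop)
        fun p => (lt_of_lt_of_le one_pos (le_max_right _ _)).ne') 1 2
  have hmax : ∀ δ, Φ δ = ∫ u in (1 : ℝ)..2, F (δ * u) / u := fun δ => by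
    refine intervalIntegral.integral_congr fun u hu => ?_
    rw [uIcc_of_le (by norm_num)] at hu
    simp only [max_eq_left hu.1]
  have hgi : ∀ s t : ℝ, 0 < s → 0 < t → IntervalIntegrable (fun h => F h / h) volume s t :=
    fun s t hs ht => by
      refine ContinuousOn.intervalIntegrable (hF.continuousOn.div continuousOn_id fun z hz => ?_)
      exact (lt_of_lt_of_le (lt_min hs ht) hz.1).ne'
  have hP : ∀ t : ℝ, 0 < t → HasDerivAt (fun t => ∫ h in (1 : ℝ)..t, F h / h) (F t / t) t :=
    fun t ht => intervalIntegral.integral_hasDerivAt_right (hgi 1 t one_pos ht)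
      (Measurable.stronglyMeasurable (by fun_prop)).aestronglyMeasurable.stronglyMeasurableAtFilter
      (hF.continuousAt.div continuousAt_id ht.ne')
  have hΦP : ∀ δ : ℝ, 0 < δ → Φ δ =
      (∫ h in (1 : ℝ)..(2 * δ), F h / h) - ∫ h in (1 : ℝ)..δ, F h / h := fun δ hδ => by
    rw [intervalIntegral.integral_interval_sub_left (hgi _ _ one_pos (by positivity))
      (hgi _ _ one_pos hδ), hmax]
    have h1 := intervalIntegral.mul_integral_comp_mul_left (a := 1) (b := 2)
      (f := fun h => F h / h) (c := δ)
    rw [mul_one, mul_comm δ 2] at h1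
    rw [← h1, ← intervalIntegral.integral_const_mul]
    refine intervalIntegral.integral_congr fun u _ => ?_
    field_simp
  have hder : ∀ δ ∈ Ioo (0 : ℝ) 1, HasDerivAt Φ ((F (2 * δ) - F δ) / δ) δ := fun δ hδ => by
    have h2 : HasDerivAt (fun δ : ℝ => ∫ h in (1 : ℝ)..(2 * δ), F h / h)
        (F (2 * δ) / (2 * δ) * 2) δ :=
      (hP (2 * δ) (by linarith [hδ.1])).comp δ (by simpa using (hasDerivAt_id δ).const_mul 2)
    have h3 := h2.sub (hP δ hδ.1)
    have e : F (2 * δ) / (2 * δ) * 2 - F δ / δ = (F (2 * δ) - F δ) / δ := by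
      have := hδ.1.ne'
      field_simp
    rw [e] at h3
    refine h3.congr_of_eventuallyEq ?_
    filter_upwards [Ioi_mem_nhds hδ.1] with t ht
    exact hΦP t ht
  rw [intervalIntegral.integral_eq_sub_of_hasDerivAt_of_le zero_le_one hΦc.continuousOn hder hi,
    hmax, hmax]
  simp only [one_mul, zero_mul, div_eq_mul_inv]
  rw [intervalIntegral.integral_const_mul, integral_inv_of_pos one_pos two_pos, div_one]

/-- The coefficients which represent `f` as a tent potential. -/
noncomputable def tentCoefficient (f : ℝ → ℝ) (p : ℝ × ℝ) : ℝ :=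
  if p.2 ∈ Ioc (1 : ℝ) 2 then f p.1 / p.2 / Real.log 2
  else if p.2 ∈ Ioc (0 : ℝ) 1 then -(secondDividedDifference f p.1 p.2 / 4 / Real.log 2) else 0

theorem measurable_secondDividedDifference {f : ℝ → ℝ} (hf : Measurable f) :
    Measurable fun p : ℝ × ℝ => secondDividedDifference f p.1 p.2 := by
  unfold secondDividedDifference
  fun_prop

theorem one_half_le_log_two : 1 / 2 ≤ Real.log 2 := by
  have := Real.log_two_gt_d9
  linarith

theorem isStripCoefficient_tentCoefficient {f : ℝ → ℝ} (hf : Measurable f) {B Z : ℝ}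
    (hB : ∀ x, |f x| ≤ B) (hZ : ∀ x h, 0 < h → |secondDividedDifference f x h| ≤ Z) :
    IsStripCoefficient (tentCoefficient f) (2 * B + Z) where
  measurable := by
    refine Measurable.ite (measurable_snd measurableSet_Ioc) (by fun_prop)
      (Measurable.ite (measurable_snd measurableSet_Ioc) ?_ measurable_const)
    exact (((measurable_secondDividedDifference hf).div_const _).div_const _).neg
  abs_le p := by
    have hl := one_half_le_log_two
    have hB0 : 0 ≤ B := (abs_nonneg _).trans (hB 0)
    have hZ0 : 0 ≤ Z := (abs_nonneg _).trans (hZ 0 1 one_pos)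
    unfold tentCoefficient
    split_ifs with h1 h2
    · rw [abs_div, abs_div, abs_of_pos (zero_lt_one.trans h1.1), abs_of_pos (by linarith : 0 < Real.log 2),
        div_div, div_le_iff₀ (mul_pos (by linarith [h1.1]) (by linarith))]
      -- This lower bound on the denominator produces the `2` in `2 * B + Z`.
      have h3 : 1 / 2 ≤ p.2 * Real.log 2 := by nlinarith [h1.1]
      have h4 := mul_le_mul_of_nonneg_left h3 (show 0 ≤ 2 * B + Z by linarith)
      linarith [hB p.1]
    · rw [abs_neg, abs_div, abs_div, abs_of_pos (by linarith : 0 < Real.log 2),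
        abs_of_pos (by norm_num : (0 : ℝ) < 4), div_div, div_le_iff₀ (by linarith)]
      have h3 : 1 ≤ 4 * Real.log 2 := by linarith
      have h4 := mul_le_mul_of_nonneg_left h3 (show 0 ≤ 2 * B + Z by linarith)
      linarith [hZ p.1 p.2 h2.1]
    · rw [abs_zero]
      linarith
  mem_strip p hp := by
    unfold tentCoefficient at hp
    split_ifs at hp with h1 h2
    · exact ⟨by linarith [h1.1], h1.2⟩
    · exact ⟨h2.1, by linarith [h2.2]⟩
    · exact absurd rfl hp

/-- With `F` the tent average of `f` at `x`, heights `h ≤ 1` integrate to `-(1 / log 2)` times the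
Frullani integral of `F`. The coefficients on `1 < h ≤ 2` are chosen to cancel its integral over
`[1, 2]`, which leaves `F 0 = f x`. -/
theorem tentPotential_tentCoefficient {f : ℝ → ℝ} (hf : Continuous f) {M : ℝ}
    (hc : IsStripCoefficient (tentCoefficient f) M) (x : ℝ) :
    tentPotential (tentCoefficient f) x = f x := by
  have hint := hc.integrable_tent_kernel x
  have hl : Real.log 2 ≠ 0 := by linarith [one_half_le_log_two]
  rw [Measure.volume_eq_prod] at hint
  rw [tentPotential, Measure.volume_eq_prod, integral_prod_symm _ hint]
  set F := tentAverage f x with hF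
  set J : ℝ → ℝ := fun h => ∫ y, tentCoefficient f (y, h) * (tent ((x - y) / h) / h) with hJ
  have hJi : Integrable J := hint.integral_prod_right
  have hJ0 : ∀ h, h ∉ Ioc (0 : ℝ) 2 → J h = 0 := fun h hh => by
    simp [hJ, hc.eq_zero (p := (_, h)) hh]
  have hJ1 : ∀ h ∈ Ioc (0 : ℝ) 1, J h = -(1 / Real.log 2) * ((F (2 * h) - F h) / h) := by
    intro h hh
    have e : ∀ y, tentCoefficient f (y, h) =
        -(1 / (4 * Real.log 2)) * secondDividedDifference f y h := fun y => by
      rw [tentCoefficient, if_neg (fun h' => absurd h'.1 (not_lt.2 hh.2)), if_pos hh]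
      field_simp
    simp only [hJ, e, mul_assoc]
    rw [integral_const_mul, integral_secondDividedDifference_mul_tent hf x hh.1]
    change _ * (4 * ((F (2 * h) - F h) / h)) = _
    field_simp
  have hJ2 : ∀ h ∈ Ioc (1 : ℝ) 2, J h = 1 / Real.log 2 * (F h / h) := by
    intro h hh
    have h0 : 0 < h := one_pos.trans hh.1
    have e : ∀ y, tentCoefficient f (y, h) = 1 / (h * Real.log 2) * f y := fun y => by
      rw [tentCoefficient, if_pos hh]
      field_simp
    simp only [hJ, e, mul_assoc]
    rw [integral_const_mul, integral_mul_tent_comp f x h0]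
    change _ * F h = _
    field_simp
  have hJI : ∀ s t, IntervalIntegrable J volume s t := fun s t => hJi.intervalIntegrable
  -- Integrability at the singular endpoint `0` is inherited from `J`, through Fubini.
  have hi : IntervalIntegrable (fun h => (F (2 * h) - F h) / h) volume 0 1 := by
    refine ((hJI 0 1).const_mul (-Real.log 2)).congr fun h hh => ?_
    rw [uIoc_of_le zero_le_one] at hh
    simp only [hJ1 h hh]
    field_simp
  calc ∫ h, J h = ∫ h in Ioc (0 : ℝ) 2, J h :=
        (setIntegral_eq_integral_of_forall_compl_eq_zero hJ0).symm
    _ = (∫ h in (0 : ℝ)..1, J h) + ∫ h in (1 : ℝ)..2, J h := by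
        rw [intervalIntegral.integral_add_adjacent_intervals (hJI _ _) (hJI _ _),
          intervalIntegral.integral_of_le zero_le_two]
    _ = -(1 / Real.log 2) * (∫ h in (0 : ℝ)..1, (F (2 * h) - F h) / h) +
        1 / Real.log 2 * ∫ h in (1 : ℝ)..2, F h / h := by
        rw [← intervalIntegral.integral_const_mul, ← intervalIntegral.integral_const_mul]
        congr 1
        · refine intervalIntegral.integral_congr_ae (ae_of_all _ fun h hh => ?_)
          rw [uIoc_of_le zero_le_one] at hh
          exact hJ1 h hh
        · refine intervalIntegral.integral_congr_ae (ae_of_all _ fun h hh => ?_)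
          rw [uIoc_of_le one_le_two] at hh
          exact hJ2 h hh
    _ = f x := by
        rw [integral_two_mul_sub_div (continuous_tentAverage hf x) hi, hF, tentAverage_zero]
        field_simp
        ring

/-! ### Splitting the coefficients and conclusion. -/

theorem measurableSet_largeDifferenceSet {f : ℝ → ℝ} (hf : Measurable f) (ε : ℝ) :
    MeasurableSet (largeDifferenceSet f ε) :=
  (measurableSet_lt measurable_const measurable_snd).inter
    (measurableSet_lt measurable_const (measurable_secondDividedDifference hf).abs)

/-- The part of the strip where the tent coefficients of `f` are not small. -/
def largeCoefficientSet (f : ℝ → ℝ) (ε : ℝ) : Set (ℝ × ℝ) :=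
  largeDifferenceSet f ε ∪ {p | 1 < p.2}

theorem measurableSet_largeCoefficientSet {f : ℝ → ℝ} (hf : Measurable f) (ε : ℝ) :
    MeasurableSet (largeCoefficientSet f ε) :=
  (measurableSet_largeDifferenceSet hf ε).union (measurableSet_lt measurable_const measurable_snd)

theorem isStripCoefficient_compl_largeCoefficientSet {f : ℝ → ℝ} (hf : Measurable f) {M ε : ℝ}
    (hc : IsStripCoefficient (tentCoefficient f) M) (hε : 0 < ε) :
    IsStripCoefficient ((largeCoefficientSet f ε)ᶜ.indicator (tentCoefficient f)) ε where
  measurable := hc.measurable.indicator (measurableSet_largeCoefficientSet hf ε).compl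
  abs_le p := by
    by_cases hp : p ∈ (largeCoefficientSet f ε)ᶜ
    · rw [indicator_of_mem hp]
      rw [largeCoefficientSet, compl_union, mem_inter_iff, mem_compl_iff, mem_compl_iff] at hp
      unfold tentCoefficient
      have hl := one_half_le_log_two
      split_ifs with h1 h2
      · exact absurd h1.1 hp.2
      · have h3 : |secondDividedDifference f p.1 p.2| ≤ ε := by
          by_contra h
          exact hp.1 ⟨h2.1, not_le.1 h⟩
        rw [abs_neg, abs_div, abs_div, abs_of_pos (by linarith : 0 < Real.log 2),
          abs_of_pos (by norm_num : (0 : ℝ) < 4), div_div, div_le_iff₀ (by linarith)]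
        -- The coefficient is at most `ε / (4 * log 2)`, and `4 * log 2 ≥ 1`.
        nlinarith
      · rw [abs_zero]
        exact hε.le
    · rw [indicator_of_notMem hp, abs_zero]
      exact hε.le
  mem_strip := (hc.indicator (measurableSet_largeCoefficientSet hf ε).compl).mem_strip

/-- The large difference set contributes `carlesonQuantity f ε`. The layer `1 < h ≤ 2` has thickness
`1` and density `1/h ≤ 1`, hence the added `1`. -/
theorem stripMeasure_largeCoefficientSet_le {f : ℝ → ℝ} (hf : Measurable f) {M ε : ℝ}
    (hc : IsStripCoefficient (tentCoefficient f) M) {u v : ℝ} (huv : u < v) :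
    stripMeasure ((largeCoefficientSet f ε).indicator (tentCoefficient f))
        (Icc u v ×ˢ Iic (v - u)) ≤
      ENNReal.ofReal M * (carlesonQuantity f ε + 1) * ENNReal.ofReal (v - u) := by
  set a := (largeCoefficientSet f ε).indicator (tentCoefficient f) with ha
  have hsa : IsStripCoefficient a M := hc.indicator (measurableSet_largeCoefficientSet hf ε)
  have hm : Measurable fun p => ‖a p‖ₑ * ENNReal.ofReal (1 / p.2) :=
    hsa.measurable.enorm.mul (by fun_prop)
  have hA := measurableSet_largeDifferenceSet hf ε
  set G : ℝ × ℝ → ℝ≥0∞ :=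
    (largeDifferenceSet f ε).indicator fun p => ENNReal.ofReal (1 / p.2) with hG
  have hGm : Measurable G := Measurable.indicator (by fun_prop) hA
  have hpt : ∀ x, ∀ h ∈ Iic (v - u), ‖a (x, h)‖ₑ * ENNReal.ofReal (1 / h) ≤
      ENNReal.ofReal M * ((Ioc 0 (v - u)).indicator (fun h => G (x, h)) h +
        (Ioc 1 2).indicator (fun _ => 1) h) := by
    intro x h hh
    by_cases h0 : a (x, h) = 0
    · simp [h0]
    have hs := hsa.mem_strip _ h0
    have hle : ‖a (x, h)‖ₑ ≤ ENNReal.ofReal M := by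
      rw [Real.enorm_eq_ofReal_abs]
      exact ENNReal.ofReal_le_ofReal (hsa.abs_le _)
    refine mul_le_mul' hle ?_
    have hmem : (x, h) ∈ largeCoefficientSet f ε := by
      by_contra hn
      exact h0 (indicator_of_notMem hn _)
    rcases hmem with hmem | hmem
    · rw [indicator_of_mem (show h ∈ Ioc 0 (v - u) from ⟨hs.1, hh⟩), hG, indicator_of_mem hmem]
      exact le_self_add
    · have h1 : 1 < h := hmem
      rw [indicator_of_mem (show h ∈ Ioc (1 : ℝ) 2 from ⟨h1, hs.2⟩)]
      refine le_trans ?_ le_add_self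
      rw [ENNReal.ofReal_le_one]
      exact (div_le_one hs.1).2 h1.le
  have hcar : ∫⁻ x in Icc u v, ∫⁻ h in Ioc 0 (v - u), G (x, h) ≤
      carlesonQuantity f ε * ENNReal.ofReal (v - u) := by
    rw [mul_comm, ← ENNReal.inv_mul_le_iff (by simpa using huv) ENNReal.ofReal_ne_top]
    exact le_iSup_of_le u (le_iSup_of_le v (le_iSup_of_le huv le_rfl))
  have hinner : ∀ x, ∫⁻ h in Iic (v - u), ‖a (x, h)‖ₑ * ENNReal.ofReal (1 / h) ≤
      ENNReal.ofReal M * ((∫⁻ h in Ioc 0 (v - u), G (x, h)) + 1) := fun x => by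
    calc _ ≤ ∫⁻ h in Iic (v - u), ENNReal.ofReal M *
          ((Ioc 0 (v - u)).indicator (fun h => G (x, h)) h + (Ioc 1 2).indicator (fun _ => 1) h) :=
          setLIntegral_mono' measurableSet_Iic (hpt x)
      _ ≤ ∫⁻ h, ENNReal.ofReal M *
          ((Ioc 0 (v - u)).indicator (fun h => G (x, h)) h + (Ioc 1 2).indicator (fun _ => 1) h) :=
          setLIntegral_le_lintegral _ _
      _ = _ := by
          rw [lintegral_const_mul' _ _ ENNReal.ofReal_ne_top,
            lintegral_add_right _ (measurable_const.indicator measurableSet_Ioc),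
            lintegral_indicator measurableSet_Ioc, lintegral_indicator measurableSet_Ioc,
            setLIntegral_const, Real.volume_Ioc]
          norm_num
  rw [stripMeasure, withDensity_apply _ (measurableSet_Icc.prod measurableSet_Iic),
    Measure.volume_eq_prod, ← Measure.prod_restrict, lintegral_prod _ hm.aemeasurable]
  calc _ ≤ ∫⁻ x in Icc u v, ENNReal.ofReal M * ((∫⁻ h in Ioc 0 (v - u), G (x, h)) + 1) :=
        lintegral_mono hinner
    _ = ENNReal.ofReal M * ((∫⁻ x in Icc u v, ∫⁻ h in Ioc 0 (v - u), G (x, h)) +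
        ENNReal.ofReal (v - u)) := by
        rw [lintegral_const_mul' _ _ ENNReal.ofReal_ne_top, lintegral_add_right _ measurable_const,
          setLIntegral_const, Real.volume_Icc, one_mul]
    _ ≤ ENNReal.ofReal M * (carlesonQuantity f ε * ENNReal.ofReal (v - u) +
        ENNReal.ofReal (v - u)) := by gcongr
    _ = _ := by ring

theorem distIBMO_le_of_carlesonQuantity_lt_top {f : ℝ → ℝ} (hf : f ∈ ZygmundClass)
    (hs : HasCompactSupport f) {ε : ℝ} (hε : 0 < ε) (hC : carlesonQuantity f ε < ∞) :
    distIBMO f ≤ 20 * ENNReal.ofReal ε := by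
  obtain ⟨hfc, hz⟩ := hf
  have hfm := hfc.measurable
  obtain ⟨B, hB⟩ := hfc.bounded_above_of_compact_support hs
  have hZ : ∀ x h, 0 < h → |secondDividedDifference f x h| ≤ (zygmundSeminorm f).toReal :=
    fun x h hh => by
      have := abs_secondDividedDifference_le f x hh
      rwa [← ENNReal.ofReal_toReal hz.ne, ENNReal.ofReal_le_ofReal_iff ENNReal.toReal_nonneg]
        at this
  have hc := isStripCoefficient_tentCoefficient hfm hB hZ
  set M := 2 * B + (zygmundSeminorm f).toReal
  have ha := hc.indicator (measurableSet_largeCoefficientSet hfm ε)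
  have hb := isStripCoefficient_compl_largeCoefficientSet hfm hc hε
  set a := (largeCoefficientSet f ε).indicator (tentCoefficient f)
  set b := (largeCoefficientSet f ε)ᶜ.indicator (tentCoefficient f)
  have hmem : tentPotential a ∈ IBMO := by
    refine ha.tentPotential_mem_IBMO
      (C := (ENNReal.ofReal M * (carlesonQuantity f ε + 1)).toNNReal) fun u v huv => ?_
    rw [ENNReal.coe_toNNReal (ENNReal.mul_ne_top ENNReal.ofReal_ne_top
      (ENNReal.add_ne_top.2 ⟨hC.ne, ENNReal.one_ne_top⟩))]
    exact stripMeasure_largeCoefficientSet_le hfm hc huv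
  have hsplit : f - tentPotential a = tentPotential b := by
    ext x
    have hab : tentCoefficient f = fun p => a p + b p :=
      (indicator_self_add_compl _ _).symm
    have h1 := tentPotential_tentCoefficient hfc hc x
    rw [hab, tentPotential_add ha hb] at h1
    rw [Pi.sub_apply, ← h1, add_sub_cancel_left]
  refine (iInf₂_le _ hmem).trans ?_
  rw [hsplit]
  refine hb.zygmundSeminorm_tentPotential_le.trans_eq ?_
  rw [ENNReal.ofReal_mul (by norm_num), ENNReal.ofReal_ofNat]

theorem theorem1 :
    ∃ C : ℝ≥0, 0 < C ∧
      ∀ f : ℝ → ℝ, f ∈ ZygmundClass → HasCompactSupport f →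
        distIBMO f ≤ C * criticalLevel f ∧ criticalLevel f ≤ C * distIBMO f := by
  -- The first inequality needs `20`, the second only `2`.
  refine ⟨20, by norm_num, fun f hf hs => ⟨?_, ?_⟩⟩
  · rw [criticalLevel, ENNReal.mul_iInf_of_ne (by norm_num) ENNReal.coe_ne_top]
    refine le_iInf fun ε => ?_
    rw [ENNReal.mul_iInf_of_ne (by norm_num) ENNReal.coe_ne_top]
    exact le_iInf fun hε => distIBMO_le_of_carlesonQuantity_lt_top hf hs hε.1 hε.2
  · refine (criticalLevel_le_two_mul_distIBMO f).trans ?_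
    gcongr
    norm_num
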